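/- Let $ID(\mathbb R)$ be the set of infinitely divisible probability measures on $\mathbb R$ and $ID(\mathbb R^+)$ the subset of those carried by $[0,\infty)$. Write $\mu\sim(\gamma,b,\nu)$ if $\mu$ has characteristic triplet $(\gamma,b,\nu)$ relative to the truncation function $\tau(x)=x\mathbf 1_{\{|x|\le1\}}$, i.e. $\gamma\in\mathbb R$, $b\ge0$, $\nu$ is a Lévy measure ($\nu(\{0\})=0$, $\int(1\wedge x^2)\,\nu(dx)<\infty$) and $\widehat\mu(z)=e^{\phi(z)}$ with $$\phi(z)=iz\gamma-\tfrac12z^2b+\int_{\mathbb R}\left(e^{izx}-1-i\tau(x)z\right)\nu(dx),\qquad z\in\mathbb R .$$ In that case, for $s\ge 0$, $\mu^s$ is the probability measure with characteristic function $e^{s\phi}$. Write $\mu\sim(\beta_0,\rho)_0$ if $\int(1\wedge|x|)\,\rho(dx)<\infty$ and $\mu\sim(\gamma,0,\rho)$ with $\beta_0=\gamma-\int_{|x|\le1}x\,\rho(dx)$. Let $\mu_L,\mu_T\in ID(\mathbb R)$ with $\mu_L\sim(\gamma,b,\nu)$ and $\mu_T\sim(\beta_0,\rho)_0$, where $\rho$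 is carried by $(0,\infty)$. Put $\overline b=b\beta_0$, $$\overline\gamma=\gamma\beta_0+\int_0^\infty\int_{|x|\le1}x\,\mu_L^s(dx)\,\rho(ds),\qquad \overline\nu(dx)=\beta_0\,\nu(dx)+\int_0^\infty\mu_L^s(dx)\,\rho(ds)\ \text{ on }\mathbb R\setminus\{0\},\quad \overline\nu(\{0\})=0 .$$ Whenever these expressions make sense (the integral in $\overline\gamma$ converges, and $\beta_0\nu$ is a nonnegative measure) and $(\overline\gamma,\overline b,\overline\nu)$ is the characteristic triplet of some $\overline\mu\in ID(\mathbb R)$, put $$\Lambda_{\mu_L}(\mu_T)=\Lambda_{\mu_T}(\mu_L)=\overline\mu .$$ Let $\mathcal D(\Lambda_{\mu_L})$, $\mathcal D(\Lambda_{\mu_T})$ be the sets of all $\mu_T$, respectively all $\mu_L$, for which this is defined, and let $\mathcal R(\Lambda_{\mu_L})$, $\mathcal R(\Lambda_{\mu_T})$ be the corresponding ranges. **Proposition.** The measure $\overline\mu$ is uniquely determined by $\mu_L$ and $\mu_T$, and the following hold. 1. For every $\mu_L\in ID(\mathbb R)$ we have $ID(\mathbb R^+)\subseteq\mathcal D(\Lambda_{\mu_L})$,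 with equality $\mathcal D(\Lambda_{\mu_L})=ID(\mathbb R^+)$ if $\mu_L$ is not a Dirac measure. For every $\mu_T\in ID(\mathbb R^+)$ we have $\mathcal D(\Lambda_{\mu_T})=ID(\mathbb R)$. 2. $\mathcal R(\Lambda_{\mu_L})\subsetneq ID(\mathbb R)$ for every $\mu_L\in ID(\mathbb R)$, and $\mathcal R(\Lambda_{\mu_T})\subsetneq ID(\mathbb R)$ for every $\mu_T\in ID(\mathbb R^+)$ that is not a Dirac measure. 3. For every $\mu_L\in ID(\mathbb R)$, both $\mathcal D(\Lambda_{\mu_L})$ and $\mathcal R(\Lambda_{\mu_L})$ are closed under convolution, and $$\Lambda_{\mu_L}(\mu^1*\mu^2)=\Lambda_{\mu_L}(\mu^1)*\Lambda_{\mu_L}(\mu^2),\qquad \mu^1,\mu^2\in\mathcal D(\Lambda_{\mu_L}).$$ 4. In contrast, there is $\mu_T\in ID(\mathbb R^+)$ for which $\mathcal R(\Lambda_{\mu_T})$ is not closed under convolution. -/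

import Mathlib

open MeasureTheory

noncomputable section

namespace LevySub

/-- The `n`-fold convolution power of a measure on `ℝ`. -/
def convIter (ν : Measure ℝ) : ℕ → Measure ℝ
  | 0 => Measure.dirac 0
  | n + 1 => Measure.conv (convIter ν n) ν

/-- `ID(ℝ)`: the infinitely divisible probability measures on `ℝ`, i.e. those which have an
`n`-th convolution root among the probability measures for every `n ≥ 1`. -/
def ID : Set (Measure ℝ) :=
  {μ | IsProbabilityMeasure μ ∧
    ∀ n : ℕ, 1 ≤ n → ∃ ν : Measure ℝ, IsProbabilityMeasure ν ∧ convIter ν n = μ}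

/-- `ID(ℝ⁺)`: the infinitely divisible probability measures carried by `[0, ∞)`. -/
def IDplus : Set (Measure ℝ) := {μ | μ ∈ ID ∧ μ (Set.Iio 0) = 0}

/-- `μ` is not a point mass. -/
def Nondegenerate (μ : Measure ℝ) : Prop := ∀ c : ℝ, μ ≠ Measure.dirac c

/-- Lévy measures on `ℝ`: no mass at `0`, and `∫ (1 ∧ |x|²) ν(dx) < ∞`. -/
def IsLevyMeasure (ν : Measure ℝ) : Prop :=
  ν {0} = 0 ∧ ∫⁻ x, ENNReal.ofReal (min 1 (|x| ^ 2)) ∂ν < ⊤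

/-- The truncation function `τ(x) = x 1_{|x| ≤ 1}`. -/
def trunc (x : ℝ) : ℝ := if |x| ≤ 1 then x else 0

/-- The characteristic exponent of the triplet `(γ, b, ν)` relative to `τ`:
`i z γ - z² b / 2 + ∫ (e^{izx} - 1 - i τ(x) z) ν(dx)`. -/
def levyExponent (γ b : ℝ) (ν : Measure ℝ) (z : ℝ) : ℂ :=
  Complex.I * z * γ - (1 / 2 : ℂ) * (z : ℂ) ^ 2 * b +
    ∫ x : ℝ, (Complex.exp (Complex.I * z * x) - 1 - Complex.I * trunc x * z) ∂ν

/-- `μ` has characteristic triplet `(γ, b, ν)` relative to `τ` (Lévy-Khintchine representation).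
Mathlib's `charFun μ z` is `∫ e^{izx} μ(dx)`. -/
structure HasTriplet (μ : Measure ℝ) (γ b : ℝ) (ν : Measure ℝ) : Prop where
  isProb : IsProbabilityMeasure μ
  gauss_nonneg : 0 ≤ b
  levy : IsLevyMeasure ν
  charFun_eq : ∀ z : ℝ, charFun μ z = Complex.exp (levyExponent γ b ν z)

/-- `μ` has characteristic pair `(β₀, ρ)₀`, i.e. triplet `(β₀, 0, ρ)₀` relative to the truncation
function `0`: `∫ (1 ∧ |x|) ρ(dx) < ∞`, and relative to `τ` the triplet is `(γ, 0, ρ)` with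
`β₀ = γ - ∫_{|x| ≤ 1} x ρ(dx)`. -/
structure HasPair (μ : Measure ℝ) (β₀ : ℝ) (ρ : Measure ℝ) : Prop where
  finite_var : ∫⁻ x, ENNReal.ofReal (min 1 |x|) ∂ρ < ⊤
  triplet : HasTriplet μ (β₀ + ∫ x in {x : ℝ | |x| ≤ 1}, x ∂ρ) 0 ρ

/-- `κ s = μ^s` for `s ≥ 0`, where `μ` is the law with triplet `(γ, b, ν)`: `μ^s` is the
probability measure with characteristic function `e^{s φ}`, `φ` the characteristic exponent. -/
def IsConvPowers (γ b : ℝ) (ν : Measure ℝ) (κ : ℝ → Measure ℝ) : Prop :=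
  ∀ s : ℝ, 0 ≤ s → IsProbabilityMeasure (κ s) ∧
    ∀ z : ℝ, charFun (κ s) z = Complex.exp (s * levyExponent γ b ν z)

/-- `(γ', b', ν')` is given by the triplet `(γ, b, ν)` of `μ_L` and the pair `(β₀, ρ)₀` of `μ_T`
through
* `b' = b β₀`,
* `γ' = γ β₀ + ∫_0^∞ ∫_{|x| ≤ 1} x μ_L^s(dx) ρ(ds)`,
* `ν'(dx) = β₀ ν(dx) + ∫_0^∞ μ_L^s(dx) ρ(ds)` on `ℝ \ {0}`.

All terms have to make sense: the outer integral in `γ'` converges, and `β₀ ν` is a (nonnegative)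
measure, which for `ν ≠ 0` means `0 ≤ β₀`. -/
def IsSubTriplet (γ b : ℝ) (ν : Measure ℝ) (β₀ : ℝ) (ρ : Measure ℝ)
    (γ' b' : ℝ) (ν' : Measure ℝ) : Prop :=
  ∃ κ : ℝ → Measure ℝ, IsConvPowers γ b ν κ ∧
    b' = b * β₀ ∧
    IntegrableOn (fun s : ℝ => ∫ x in {x : ℝ | |x| ≤ 1}, x ∂(κ s)) (Set.Ioi 0) ρ ∧
    γ' = γ * β₀ + ∫ s in Set.Ioi (0 : ℝ), (∫ x in {x : ℝ | |x| ≤ 1}, x ∂(κ s)) ∂ρ ∧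
    (ν ≠ 0 → 0 ≤ β₀) ∧
    ∀ A : Set ℝ, MeasurableSet A → (0 : ℝ) ∉ A →
      ν' A = ENNReal.ofReal β₀ * ν A + ∫⁻ s in Set.Ioi (0 : ℝ), κ s A ∂ρ

/-- The graph of `Λ`: `Λ(μ_L, μ_T)` is defined and equal to `μ'`. Here `μ_L ∈ ID(ℝ)` has triplet
`(γ, b, ν)`, `μ_T ∈ ID(ℝ)` has pair `(β₀, ρ)₀` with `ρ` a measure on `(0, ∞)`, and the triplet
`(γ', b', ν')` formed from them is the characteristic triplet of `μ' ∈ ID(ℝ)`. -/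
def LambdaGraph (μL μT μ' : Measure ℝ) : Prop :=
  μL ∈ ID ∧ μT ∈ ID ∧ μ' ∈ ID ∧
  ∃ (γ b : ℝ) (ν : Measure ℝ) (β₀ : ℝ) (ρ : Measure ℝ) (γ' b' : ℝ) (ν' : Measure ℝ),
    HasTriplet μL γ b ν ∧ HasPair μT β₀ ρ ∧ ρ (Set.Iic 0) = 0 ∧
    IsSubTriplet γ b ν β₀ ρ γ' b' ν' ∧ HasTriplet μ' γ' b' ν'

open Classical in
/-- `Λ(μ_L, μ_T)`, with the value `0` where `Λ` is not defined. -/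
def Lambda (μL μT : Measure ℝ) : Measure ℝ :=
  if h : ∃ μ', LambdaGraph μL μT μ' then h.choose else 0

/-- The domain of `Λ_{μ_L} = Λ(μ_L, ·)`. -/
def domL (μL : Measure ℝ) : Set (Measure ℝ) := {μT | ∃ μ', LambdaGraph μL μT μ'}

/-- The domain of `Λ_{μ_T} = Λ(·, μ_T)`. -/
def domT (μT : Measure ℝ) : Set (Measure ℝ) := {μL | ∃ μ', LambdaGraph μL μT μ'}

/-- The range of `Λ_{μ_L}`. -/
def rangeL (μL : Measure ℝ) : Set (Measure ℝ) := (fun μT => Lambda μL μT) '' domL μL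

/-- The range of `Λ_{μ_T}`. -/
def rangeT (μT : Measure ℝ) : Set (Measure ℝ) := (fun μL => Lambda μL μT) '' domT μT

/-- Closedness under convolution. -/
def ConvClosed (S : Set (Measure ℝ)) : Prop := ∀ μ ∈ S, ∀ η ∈ S, Measure.conv μ η ∈ S

end LevySub

end

open MeasureTheory
open Filter Topology ProbabilityTheory
open scoped ENNReal NNReal

namespace LevySub

/-! The core is the Lévy–Khintchine correspondence, set up so that it follows from Lévy's continuity
theorem. Exponents are written as `icz + ∫ levyKernel z dM` with `M` a finite measure whose atom at
0 carries the Gaussian part. The kernel is chosen so that the operator `f ↦ f(z) - ½ ∫_{-1}^{1} f(z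
+ u) du` turns the exponent into the characteristic function of `M`
(`canonicalExponent_sub_average`). This gives uniqueness of `(c, M)`. Applied to the convolution
roots `r_n` of an infinitely divisible law, it also gives weak convergence of the measures `n (1 -
sinc x) r_n(dx)`, hence the representation (`exists_canonicalExponent_of_mem_ID`). Compound Poisson
approximation gives the converse (`exists_prob_canonicalExponent`).

On the half-line the same limit argument is run with the weight `1 - e^{-x}`. Its convergence comes
from comparing a law with its exponential tilt, which is again infinitely divisible. The outcome is
a nonnegative drift and a Lévy measure on `(0, ∞)` integrating `1 ∧ x`
(`exists_hasPair_of_mem_IDplus`); `HasPair.measure_Iio` is the converse.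

Given this, `Λ` is defined on `ID(ℝ⁺)` because `∫ (1 ∧ x²) dμ^s` and `∫ τ dμ^s` are `O(1 ∧ s)`
(`exists_convPowers_bound`), which `ρ` integrates. It is single-valued because characteristics and
convolution powers are unique. If `μ_L` is not a point mass, then either `ν ≠ 0`, where `β₀ ≥ 0` is
required, or `b > 0`, where `b β₀ ≥ 0` forces it; so `μ_T` lives on the half-line.

The ranges are proper because a Gaussian image needs `b > 0` and then `ρ = 0`: each `μ_L^s` with `s
> 0` charges the complement of 0 (`IsSubTriplet.eq_zero`). Only a deterministic time change remains,
and it misses a suitable Gaussian law. For fixed `μ_L` the new triplet is additive in `(β₀, ρ)`,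
which gives the homomorphism property. For `μ_T` Poisson with rate 1 the new Lévy measure is `μ_L`
off 0, of mass at most 1, so convolving two images can leave the range. -/

/-! ### Continuous logarithms and Lévy's continuity theorem -/

/-- Both functions lift the same path along the covering `exp : ℂ → ℂ \ {0}`, and a lift is
determined by its starting point. -/
theorem eq_of_exp_eq {f g : ℝ → ℂ} (hf : Continuous f) (hg : Continuous g) (h0 : f 0 = g 0)
    (h : ∀ z, Complex.exp (f z) = Complex.exp (g z)) : f = g := by
  obtain ⟨F, -, hF⟩ := Complex.isCoveringMapOn_exp.existsUnique_continuousMap_lifts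
    (⟨fun z => Complex.exp (f z), by fun_prop⟩ : C(ℝ, ℂ)) (a₀ := 0) (e₀ := f 0) rfl
    (fun a => by simp [Complex.exp_ne_zero])
  have h1 := hF ⟨f, hf⟩ ⟨rfl, rfl⟩
  have h2 := hF ⟨g, hg⟩ ⟨h0.symm, by ext z; simp [h]⟩
  exact congrArg (fun F : C(ℝ, ℂ) => (F : ℝ → ℂ)) (h1.trans h2.symm)

theorem exists_continuous_log {f : ℝ → ℂ} (hf : Continuous f) (h0 : f 0 = 1) (hne : ∀ z, f z ≠ 0) :
    ∃ φ : ℝ → ℂ, Continuous φ ∧ φ 0 = 0 ∧ ∀ z, f z = Complex.exp (φ z) := by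
  obtain ⟨F, ⟨hF0, hF⟩, -⟩ := Complex.isCoveringMapOn_exp.existsUnique_continuousMap_lifts
    (⟨f, hf⟩ : C(ℝ, ℂ)) (a₀ := 0) (e₀ := 0) (by simp [h0]) (fun a => by simp [hne])
  exact ⟨F, F.continuous, hF0, fun z => (congrFun hF z).symm⟩

/-- Lévy's continuity theorem for finite measures, with the existence of the limit. -/
theorem exists_tendsto_of_tendsto_charFun {M : ℕ → FiniteMeasure ℝ} {g : ℝ → ℂ}
    (hg : ContinuousAt g 0)
    (h : ∀ t, Tendsto (fun n => charFun (M n : Measure ℝ) t) atTop (𝓝 (g t))) :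
    ∃ L : FiniteMeasure ℝ, Tendsto M atTop (𝓝 L) ∧ ∀ t, charFun (L : Measure ℝ) t = g t := by
  have hmass : ∀ n, charFun (M n : Measure ℝ) 0 = ((M n).mass : ℂ) := by
    intro n
    rw [charFun_zero]
    rfl
  have h0 : Tendsto (fun n => ((M n).mass : ℂ)) atTop (𝓝 (g 0)) := by
    simpa only [hmass] using h 0
  have h0' : Tendsto (fun n => ((M n).mass : ℝ)) atTop (𝓝 (g 0).re) := by
    simpa [Function.comp_def] using (Complex.continuous_re.tendsto _).comp h0
  obtain ⟨m, hm⟩ : ∃ m : ℝ≥0, (m : ℝ) = (g 0).re :=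
    ⟨⟨(g 0).re, ge_of_tendsto' h0' fun n => NNReal.coe_nonneg _⟩, rfl⟩
  have hgm : g 0 = (m : ℂ) := by
    refine tendsto_nhds_unique h0 ?_
    rw [← hm] at h0'
    exact_mod_cast (Complex.continuous_ofReal.tendsto _).comp h0'
  have hmm : Tendsto (fun n => (M n).mass) atTop (𝓝 m) := by
    rw [← hm] at h0'
    exact_mod_cast h0'
  have hfin : ∀ L : FiniteMeasure ℝ, Tendsto M atTop (𝓝 L) → ∀ t, charFun (L : Measure ℝ) t = g t := by
    intro L hL t
    refine tendsto_nhds_unique ?_ (h t)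
    simp_rw [charFun_eq_integral_innerProbChar]
    exact (FiniteMeasure.tendsto_iff_forall_integral_rclike_tendsto ℂ).1 hL _
  -- Normalisation is meaningless when the limiting mass vanishes; the limit is then the zero
  -- measure.
  by_cases hm0 : m = 0
  · refine ⟨0, ?_, hfin _ ?_⟩ <;>
    · refine FiniteMeasure.tendsto_zero_of_tendsto_zero_mass ?_
      rwa [hm0] at hmm
  have hcf : ∀ n, (M n).mass ≠ 0 → ∀ t, charFun ((M n).normalize : Measure ℝ) t
      = ((M n).mass : ℂ)⁻¹ * charFun (M n : Measure ℝ) t := by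
    intro n hn t
    rw [charFun_apply, charFun_apply, FiniteMeasure.toMeasure_normalize_eq_of_nonzero _
      ((FiniteMeasure.mass_nonzero_iff _).1 hn), integral_smul_nnreal_measure]
    rw [NNReal.smul_def]
    simp
  have hlim : ∀ t, Tendsto (fun n => charFun ((M n).normalize : Measure ℝ) t) atTop
      (𝓝 ((m : ℂ)⁻¹ * g t)) := by
    intro t
    have h1 : Tendsto (fun n => ((M n).mass : ℂ)⁻¹ * charFun (M n : Measure ℝ) t) atTop
      (𝓝 ((m : ℂ)⁻¹ * g t)) := by
      refine Tendsto.mul (Tendsto.inv₀ (hgm ▸ h0) ?_) (h t)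
      exact_mod_cast hm0
    refine h1.congr' ?_
    filter_upwards [hmm.eventually_ne hm0] with n hn
    exact (hcf n hn t).symm
  -- Continuity of the limit at 0 gives tightness. A subsequential limit then identifies the limit
  -- function as a characteristic function, after which the whole sequence converges.
  have htight := isTightMeasureSet_of_tendsto_charFun
    (μ := fun n => ((M n).normalize : Measure ℝ)) (f := fun t => (m : ℂ)⁻¹ * g t)
    (by fun_prop) hlim
  have hcomp : IsCompact (closure (Set.range fun n => (M n).normalize)) := by
    refine isCompact_closure_of_isTightMeasureSet ?_
    convert! htight
    ext ν
    simp [eq_comm]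
  obtain ⟨P, -, a, ha, hP⟩ := hcomp.tendsto_subseq
    (x := fun n => (M n).normalize) (fun n => subset_closure ⟨n, rfl⟩)
  have hcP : ∀ t, charFun (P : Measure ℝ) t = (m : ℂ)⁻¹ * g t := by
    intro t
    refine tendsto_nhds_unique ?_ ((hlim t).comp ha.tendsto_atTop)
    exact ProbabilityMeasure.tendsto_iff_tendsto_charFun.1 hP t
  have hPt : Tendsto (fun n => (M n).normalize) atTop (𝓝 P) :=
    ProbabilityMeasure.tendsto_iff_tendsto_charFun.2 (by simpa only [hcP] using hlim)
  have hmt : Tendsto M atTop (𝓝 (m • P.toFiniteMeasure)) := by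
    have hms : ∀ s, (m • P.toFiniteMeasure) s = m * P s := fun s => by
      rw [FiniteMeasure.coeFn_smul]
      rfl
    have hmP : (m • P.toFiniteMeasure).mass = m := by
      rw [FiniteMeasure.mass, hms, ProbabilityMeasure.coeFn_univ, mul_one]
    have hne : m • P.toFiniteMeasure ≠ 0 := by
      rw [← FiniteMeasure.mass_nonzero_iff, hmP]
      exact hm0
    rw [← FiniteMeasure.tendsto_normalize_iff_tendsto hne, hmP]
    refine ⟨?_, hmm⟩
    convert! hPt
    refine ProbabilityMeasure.eq_of_forall_apply_eq _ _ fun s hs => ?_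
    rw [FiniteMeasure.normalize_eq_of_nonzero _ hne, hmP, hms, inv_mul_cancel_left₀ hm0]
  exact ⟨_, hmt, hfin _ hmt⟩

/-- The clause on open sets is the portmanteau inequality; it lets laws carried by `[0, ∞)` stay
there in the limit. -/
theorem exists_prob_of_tendsto_charFun {μ : ℕ → Measure ℝ} (hμ : ∀ n, IsProbabilityMeasure (μ n))
    {g : ℝ → ℂ} (hg : ContinuousAt g 0)
    (h : ∀ t, Tendsto (fun n => charFun (μ n) t) atTop (𝓝 (g t))) :
    ∃ P : Measure ℝ, IsProbabilityMeasure P ∧ (∀ t, charFun P t = g t) ∧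
      ∀ U : Set ℝ, IsOpen U → (∀ n, μ n U = 0) → P U = 0 := by
  let M : ℕ → FiniteMeasure ℝ := fun n => ⟨μ n, inferInstance⟩
  obtain ⟨L, hL, hLg⟩ := exists_tendsto_of_tendsto_charFun (M := M) hg h
  have hm : L.mass = 1 := by
    have := (FiniteMeasure.continuous_mass.tendsto _).comp hL
    refine tendsto_nhds_unique this ?_
    have h1 : ∀ n, (M n).mass = 1 := fun n =>
      ENNReal.coe_injective ((FiniteMeasure.ennreal_mass (μ := M n)).trans (hμ n).measure_univ)
    simp [Function.comp_def, h1]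
  have hP : IsProbabilityMeasure (L : Measure ℝ) := ⟨by
    rw [← FiniteMeasure.ennreal_mass, hm]; rfl⟩
  refine ⟨L, hP, hLg, fun U hU hz => ?_⟩
  have h2 := ProbabilityMeasure.le_liminf_measure_open_of_tendsto
    (μ := ⟨L, hP⟩) (μs := fun n => ⟨μ n, hμ n⟩) (L := atTop)
    (ProbabilityMeasure.tendsto_iff_tendsto_charFun.2 fun t => by simpa [hLg] using h t) hU
  simpa [hz] using h2

/-! ### Convolution roots and the distinguished exponent -/

theorem convIter_spec {ν : Measure ℝ} (hν : IsProbabilityMeasure ν) (n : ℕ) :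
    IsProbabilityMeasure (convIter ν n) ∧ ∀ t, charFun (convIter ν n) t = charFun ν t ^ n := by
  induction n with
  | zero =>
    refine ⟨by unfold convIter; infer_instance, fun t => ?_⟩
    simp [convIter, charFun_dirac]
  | succ n ih =>
    have := ih.1
    refine ⟨by unfold convIter; infer_instance, fun t => ?_⟩
    rw [convIter, charFun_conv, ih.2, pow_succ]

theorem mem_ID_iff {μ : Measure ℝ} : μ ∈ ID ↔ IsProbabilityMeasure μ ∧
    ∀ n : ℕ, 1 ≤ n → ∃ ν : Measure ℝ, IsProbabilityMeasure ν ∧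
      ∀ t, charFun ν t ^ n = charFun μ t := by
  refine ⟨fun h => ⟨h.1, fun n hn => ?_⟩, fun h => ⟨h.1, fun n hn => ?_⟩⟩
  · obtain ⟨ν, hν, h⟩ := h.2 n hn
    exact ⟨ν, hν, fun t => by rw [← (convIter_spec hν n).2, h]⟩
  · obtain ⟨ν, hν, h'⟩ := h.2 n hn
    have := (convIter_spec hν n).1
    have := h.1
    exact ⟨ν, hν, Measure.ext_of_charFun (funext fun t => by rw [(convIter_spec hν n).2, h'])⟩

theorem conv_mem_ID {μ η : Measure ℝ} (hμ : μ ∈ ID) (hη : η ∈ ID) : Measure.conv μ η ∈ ID := by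
  rw [mem_ID_iff] at *
  have := hμ.1
  have := hη.1
  refine ⟨inferInstance, fun n hn => ?_⟩
  obtain ⟨ν₁, h₁, h₁'⟩ := hμ.2 n hn
  obtain ⟨ν₂, h₂, h₂'⟩ := hη.2 n hn
  exact ⟨Measure.conv ν₁ ν₂, inferInstance, fun t => by
    rw [charFun_conv, charFun_conv, mul_pow, h₁', h₂']⟩

/-- Integrate `1 - cos 2y = 2 (1 - cos² y) ≤ 4 (1 - cos y)`. -/
theorem one_sub_re_charFun_two_mul_le (μ : Measure ℝ) [IsProbabilityMeasure μ] (z : ℝ) :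
    1 - (charFun μ (2 * z)).re ≤ 4 * (1 - (charFun μ z).re) := by
  have hre : ∀ t, (charFun μ t).re = ∫ x, Real.cos (t * x) ∂μ := by
    intro t
    rw [charFun_apply_real]
    have hi : Integrable (fun x : ℝ => Complex.exp (t * x * Complex.I)) μ := by
      refine Integrable.of_bound (by fun_prop) 1 (.of_forall fun x => ?_)
      rw [← Complex.ofReal_mul, Complex.norm_exp_ofReal_mul_I]
    rw [show (∫ x : ℝ, Complex.exp (t * x * Complex.I) ∂μ).re
      = ∫ x : ℝ, (Complex.exp (t * x * Complex.I)).re ∂μ from (integral_re hi).symm]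
    refine integral_congr_ae (.of_forall fun x => ?_)
    simp only
    rw [← Complex.ofReal_mul, Complex.exp_ofReal_mul_I_re]
  have hi : ∀ t : ℝ, Integrable (fun x : ℝ => Real.cos (t * x)) μ := fun t =>
    Integrable.of_bound (by fun_prop) 1 (.of_forall fun x => by
      simpa using Real.abs_cos_le_one (t * x))
  have h1 : ∀ t, 1 - (charFun μ t).re = ∫ x, (1 - Real.cos (t * x)) ∂μ := by
    intro t
    rw [hre, integral_sub (integrable_const _) (hi t)]
    simp
  rw [h1, h1, ← integral_const_mul]
  refine integral_mono ((integrable_const _).sub (hi _)) (((integrable_const _).sub (hi _)).const_mul _)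
    fun x => ?_
  simp only
  rw [mul_assoc, Real.cos_two_mul]
  nlinarith [sq_nonneg (1 - Real.cos (z * x))]

/-- Symmetrise: the convolution of `μ` with its reflection has characteristic function `|charFun
μ|²`. -/
theorem one_sub_normSq_charFun_two_mul_le (μ : Measure ℝ) [IsProbabilityMeasure μ] (z : ℝ) :
    1 - Complex.normSq (charFun μ (2 * z)) ≤ 4 * (1 - Complex.normSq (charFun μ z)) := by
  have : IsProbabilityMeasure (μ.map (fun x => (-1 : ℝ) * x)) :=
    Measure.isProbabilityMeasure_map (by fun_prop)
  have h : ∀ t, (charFun (Measure.conv μ (μ.map (fun x => (-1 : ℝ) * x))) t).re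
      = Complex.normSq (charFun μ t) := by
    intro t
    rw [charFun_conv, charFun_map_mul, neg_one_mul, charFun_neg, Complex.mul_conj,
      Complex.ofReal_re]
  rw [← h, ← h]
  exact one_sub_re_charFun_two_mul_le _ z

/-- A sequence `μ n`, `n ≥ 1`, of `n`-th convolution roots of `μ`. -/
structure IsRootSeq (μ : Measure ℝ) (r : ℕ → Measure ℝ) : Prop where
  prob : IsProbabilityMeasure μ
  prob_root : ∀ n, IsProbabilityMeasure (r n)
  pow_eq : ∀ n, 1 ≤ n → ∀ t, charFun (r n) t ^ n = charFun μ t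

theorem exists_isRootSeq {μ : Measure ℝ} (h : μ ∈ ID) : ∃ r, IsRootSeq μ r := by
  obtain ⟨h1, h2⟩ := mem_ID_iff.1 h
  have : ∀ n : ℕ, ∃ ν : Measure ℝ, IsProbabilityMeasure ν ∧
      (1 ≤ n → ∀ t, charFun ν t ^ n = charFun μ t) := by
    intro n
    by_cases hn : 1 ≤ n
    · obtain ⟨ν, hν⟩ := h2 n hn
      exact ⟨ν, hν.1, fun _ => hν.2⟩
    · exact ⟨μ, h1, fun h => absurd h hn⟩
  choose r hr using this
  exact ⟨r, h1, fun n => (hr n).1, fun n => (hr n).2⟩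

/-- The characteristic function is nonzero near 0 by continuity. The doubling inequality, applied to
a high root, carries nonvanishing from `z` to `2z`, and repeated doubling reaches every point. -/
theorem IsRootSeq.charFun_ne_zero {μ : Measure ℝ} {r : ℕ → Measure ℝ} (h : IsRootSeq μ r) (z : ℝ) :
    charFun μ z ≠ 0 := by
  have := h.prob
  have := h.prob_root
  have hdouble : ∀ z, charFun μ z ≠ 0 → charFun μ (2 * z) ≠ 0 := by
    intro z hz
    have hlim : Tendsto (fun n : ℕ => Complex.normSq (charFun μ z) ^ ((n : ℝ)⁻¹)) atTop (𝓝 1) := by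
      have := (Real.continuous_const_rpow (Complex.normSq_pos.2 hz).ne').tendsto 0
      rw [Real.rpow_zero] at this
      exact this.comp tendsto_inv_atTop_nhds_zero_nat
    -- Above `3/4` the right side `4 (1 - |·|²)` of the doubling inequality is below 1, so the root
    -- cannot vanish at `2z`.
    obtain ⟨n, hn, hn1⟩ := ((hlim.eventually (lt_mem_nhds (show (3 / 4 : ℝ) < 1 by norm_num))).and
      (eventually_ge_atTop 1)).exists
    have h1 : Complex.normSq (charFun (r n) z) = Complex.normSq (charFun μ z) ^ ((n : ℝ)⁻¹) := by
      rw [← h.pow_eq n hn1, map_pow, Real.pow_rpow_inv_natCast (Complex.normSq_nonneg _) (by lia)]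
    have h2 := one_sub_normSq_charFun_two_mul_le (r n) z
    rw [← h.pow_eq n hn1]
    refine pow_ne_zero _ fun h0 => ?_
    rw [h0, h1] at h2
    simp at h2
    linarith
  have hpow : ∀ (k : ℕ) z, charFun μ z ≠ 0 → charFun μ (2 ^ k * z) ≠ 0 := by
    intro k
    induction k with
    | zero => simp
    | succ k ih =>
      intro z hz
      rw [pow_succ', mul_assoc]
      exact hdouble _ (ih z hz)
  have hev : ∀ᶠ y in 𝓝 (0 : ℝ), charFun μ y ≠ 0 :=
    (continuous_charFun (μ := μ)).continuousAt.eventually_ne (by simp)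
  have ht : Tendsto (fun k : ℕ => ((2 : ℝ)⁻¹) ^ k * z) atTop (𝓝 0) := by
    simpa using (tendsto_pow_atTop_nhds_zero_of_lt_one (by norm_num : (0 : ℝ) ≤ 2⁻¹)
      (by norm_num)).mul_const z
  obtain ⟨k, hk⟩ := (ht.eventually hev).exists
  have := hpow k _ hk
  rwa [← mul_assoc, ← mul_pow, mul_inv_cancel₀ (by norm_num), one_pow, one_mul] at this

/-- If `φ_n` is the continuous logarithm of the `n`-th root vanishing at 0, then `n φ_n` is one for
`μ`, so it equals `φ`. -/
theorem IsRootSeq.exists_exponent {μ : Measure ℝ} {r : ℕ → Measure ℝ} (h : IsRootSeq μ r) :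
    ∃ φ : ℝ → ℂ, Continuous φ ∧ φ 0 = 0 ∧ (∀ z, charFun μ z = Complex.exp (φ z)) ∧
      ∀ n, 1 ≤ n → ∀ z, charFun (r n) z = Complex.exp (φ z / n) := by
  have := h.prob
  have := h.prob_root
  obtain ⟨φ, hφ, h0, he⟩ := exists_continuous_log (continuous_charFun (μ := μ)) (by simp)
    h.charFun_ne_zero
  refine ⟨φ, hφ, h0, he, fun n hn z => ?_⟩
  have hn0 : (n : ℂ) ≠ 0 := by exact_mod_cast (by lia : n ≠ 0)
  obtain ⟨φn, hφn, h0n, hen⟩ := exists_continuous_log (continuous_charFun (μ := r n)) (by simp)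
    fun z hz => h.charFun_ne_zero z (by rw [← h.pow_eq n hn, hz, zero_pow (by lia)])
  have : (fun z => n * φn z) = φ := by
    refine eq_of_exp_eq (by fun_prop) hφ (by simp [h0, h0n]) fun z => ?_
    rw [Complex.exp_nat_mul, ← hen, h.pow_eq n hn, he]
  rw [hen, ← this]
  simp [hn0]

/-- Mean value inequality on the left half-plane, which is convex and where `|exp| ≤ 1`. -/
theorem norm_exp_sub_one_le_of_re_nonpos {w : ℂ} (hw : w.re ≤ 0) : ‖Complex.exp w - 1‖ ≤ ‖w‖ := by
  have := Convex.norm_image_sub_le_of_norm_deriv_le (f := Complex.exp) (C := 1)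
    (s := {z : ℂ | z.re ≤ 0}) (x := 0) (y := w) (fun x _ => Complex.differentiableAt_exp)
    (fun x hx => by simpa [Complex.norm_exp] using hx) (convex_halfSpace_re_le 0) (by simp) hw
  simpa using this

theorem tendsto_nat_mul_exp_div_sub_one (w : ℂ) :
    Tendsto (fun n : ℕ => (n : ℂ) * (Complex.exp (w / n) - 1)) atTop (𝓝 w) := by
  have hd : HasDerivAt (fun t : ℂ => Complex.exp (t * w)) w 0 := by
    have := ((hasDerivAt_id (0 : ℂ)).mul_const w).cexp
    simpa using this
  have h1 := hd.tendsto_slope_zero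
  have h2 : Tendsto (fun n : ℕ => ((n : ℂ))⁻¹) atTop (𝓝[≠] 0) := by
    refine tendsto_nhdsWithin_iff.2 ⟨?_, ?_⟩
    · exact tendsto_inv_atTop_nhds_zero_nat
    · filter_upwards [eventually_ge_atTop 1] with n hn
      simpa using (by lia : n ≠ 0)
  refine (h1.comp h2).congr fun n => ?_
  simp [div_eq_inv_mul]

/-! ### The weight `1 - sinc` and the Lévy kernel -/

/-- The weight `1 - sin x / x`, comparable to `1 ∧ x²`. -/
noncomputable def levyWeight (x : ℝ) : ℝ := 1 - Real.sinc x

theorem continuous_levyWeight : Continuous levyWeight := continuous_const.sub Real.continuous_sinc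

theorem levyWeight_nonneg (x : ℝ) : 0 ≤ levyWeight x := sub_nonneg.2 (Real.sinc_le_one x)

theorem levyWeight_le_two (x : ℝ) : levyWeight x ≤ 2 := by
  have := Real.neg_one_le_sinc x
  unfold levyWeight
  linarith

@[simp] theorem levyWeight_zero : levyWeight 0 = 0 := by simp [levyWeight]

theorem mul_levyWeight {x : ℝ} (hx : x ≠ 0) : x * levyWeight x = x - Real.sin x := by
  rw [levyWeight, Real.sinc_of_ne_zero hx]
  field_simp

theorem abs_levyWeight_sub_le {x : ℝ} (hx : |x| ≤ 1) :
    |levyWeight x - x ^ 2 / 6| ≤ |x| ^ 3 * (5 / 96) := by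
  rcases eq_or_ne x 0 with rfl | h0
  · simp
  have h1 := Real.sin_bound hx
  have h2 : x * (levyWeight x - x ^ 2 / 6) = -(Real.sin x - (x - x ^ 3 / 6)) := by
    rw [mul_sub, mul_levyWeight h0]
    ring
  have h3 : |x| * |levyWeight x - x ^ 2 / 6| ≤ |x| * (|x| ^ 3 * (5 / 96)) := by
    rw [← abs_mul, h2, abs_neg]
    calc _ ≤ _ := h1
      _ ≤ |x| ^ 4 * (5 / 96) := by
        have : |x| ^ 5 ≤ |x| ^ 4 := pow_le_pow_of_le_one (abs_nonneg x) hx (by norm_num)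
        nlinarith [pow_nonneg (abs_nonneg x) 4]
      _ = _ := by ring
  exact le_of_mul_le_mul_left h3 (abs_pos.2 h0)

theorem mul_sq_le_levyWeight {x : ℝ} (hx : |x| ≤ 1) : 11 / 96 * x ^ 2 ≤ levyWeight x := by
  have h1 := (abs_le.1 (abs_levyWeight_sub_le hx)).1
  have h2 : |x| ^ 3 ≤ x ^ 2 := by
    rw [← sq_abs x]
    exact pow_le_pow_of_le_one (abs_nonneg x) hx (by norm_num)
  linarith

theorem levyWeight_le_sq {x : ℝ} (hx : |x| ≤ 1) : levyWeight x ≤ x ^ 2 := by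
  have h1 := (abs_le.1 (abs_levyWeight_sub_le hx)).2
  have h2 : |x| ^ 3 ≤ x ^ 2 := by
    rw [← sq_abs x]
    exact pow_le_pow_of_le_one (abs_nonneg x) hx (by norm_num)
  nlinarith [sq_nonneg x]

/-- The identity `sinc x = sinc (x/2) cos (x/2)`, together with `sinc (x/2) ≥ 0`. It extends the
quadratic lower bound from `|x| ≤ 1` to `|x| ≤ 2`, beyond which `sinc x ≤ 1/2`. -/
theorem levyWeight_half_le {x : ℝ} (hx : |x| ≤ 2) : levyWeight (x / 2) ≤ levyWeight x := by
  rcases eq_or_ne x 0 with rfl | h0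
  · simp
  have hs : 0 ≤ Real.sinc (x / 2) := by
    have := levyWeight_le_sq (x := x / 2) (by rw [abs_div, abs_two]; linarith)
    have h2 : (x / 2) ^ 2 ≤ 1 := by
      have := abs_le.1 hx
      nlinarith
    unfold levyWeight at this
    linarith
  have h : Real.sinc x = Real.sinc (x / 2) * Real.cos (x / 2) := by
    rw [Real.sinc_of_ne_zero h0, Real.sinc_of_ne_zero (by simpa using h0)]
    have := Real.sin_two_mul (x / 2)
    rw [mul_div_cancel₀ x two_ne_zero] at this
    rw [this]
    field_simp
  unfold levyWeight
  rw [h]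
  nlinarith [Real.cos_le_one (x / 2)]

theorem min_le_levyWeight (x : ℝ) : min 1 (|x| ^ 2) ≤ 40 * levyWeight x := by
  rcases le_or_gt |x| 2 with hx | hx
  -- At `x/2` the lower bound is `(11/384) x²`, and `384/11 < 40`.
  · have h1 := mul_sq_le_levyWeight (x := x / 2) (by rw [abs_div, abs_two]; linarith)
    have h2 := levyWeight_half_le hx
    refine (min_le_right _ _).trans ?_
    rw [sq_abs]
    nlinarith [sq_nonneg x]
  · have h0 : x ≠ 0 := by
      rintro rfl
      simp at hx
      linarith
    have h1 := Real.sinc_le_inv_abs h0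
    have h2 : |x|⁻¹ ≤ 2⁻¹ := inv_anti₀ (by norm_num) hx.le
    refine (min_le_left _ _).trans ?_
    unfold levyWeight
    linarith

theorem levyWeight_le_min (x : ℝ) : levyWeight x ≤ 2 * min 1 (|x| ^ 2) := by
  rcases le_or_gt |x| 1 with hx | hx
  · have h1 : |x| ^ 2 ≤ 1 := pow_le_one₀ (abs_nonneg x) hx
    rw [min_eq_right h1, sq_abs]
    nlinarith [levyWeight_le_sq hx, sq_nonneg x]
  · have h1 : 1 ≤ |x| ^ 2 := one_le_pow₀ hx.le
    rw [min_eq_left h1]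
    linarith [levyWeight_le_two x]

theorem levyWeight_pos {x : ℝ} (hx : x ≠ 0) : 0 < levyWeight x := by
  have h := min_le_levyWeight x
  have : 0 < min 1 (|x| ^ 2) := lt_min one_pos (pow_pos (abs_pos.2 hx) 2)
  linarith

theorem abs_sub_sin_le {x : ℝ} (hx : |x| ≤ 1) : |x - Real.sin x| ≤ x ^ 2 := by
  rcases eq_or_ne x 0 with rfl | h0
  · simp
  rw [← mul_levyWeight h0, abs_mul, abs_of_nonneg (levyWeight_nonneg x)]
  nlinarith [levyWeight_le_sq hx, levyWeight_nonneg x, abs_nonneg x]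

/-- The compensated exponential `e^{izx} - 1 - iz sin x`. -/
noncomputable def sinCompensated (z x : ℝ) : ℂ :=
  Complex.exp (Complex.I * z * x) - 1 - Complex.I * z * Real.sin x

theorem norm_exp_I_mul_mul (z x : ℝ) : ‖Complex.exp (Complex.I * z * x)‖ = 1 := by
  rw [mul_assoc, ← Complex.ofReal_mul, Complex.norm_exp_I_mul_ofReal]

theorem norm_exp_sub_one_sub_le (z x : ℝ) :
    ‖Complex.exp (Complex.I * z * x) - 1 - Complex.I * z * x‖ ≤ 3 * (z * x) ^ 2 := by
  have hn : ‖Complex.I * z * x‖ = |z * x| := by simp [abs_mul]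
  rcases le_or_gt |z * x| 1 with h | h
  · have := Complex.exp_bound (hn.trans_le h) (n := 2) (by norm_num)
    rw [Finset.sum_range_succ, Finset.sum_range_one] at this
    simp only [pow_zero, Nat.factorial, Nat.cast_one, div_one, pow_one] at this
    rw [sub_sub]
    norm_num at this ⊢
    refine this.trans ?_
    rw [← abs_mul, sq_abs, mul_pow]
    nlinarith [mul_nonneg (sq_nonneg z) (sq_nonneg x)]
  · calc _ ≤ ‖Complex.exp (Complex.I * z * x)‖ + ‖(1 : ℂ)‖ + ‖Complex.I * z * x‖ :=
        (norm_sub_le _ _).trans (add_le_add_left (norm_sub_le _ _) _)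
      _ = 2 + |z * x| := by rw [hn, norm_exp_I_mul_mul]; norm_num
      _ ≤ _ := by rw [← sq_abs (z * x)]; nlinarith

theorem norm_sinCompensated_le (z x : ℝ) :
    ‖sinCompensated z x‖ ≤ (2 + |z| + 3 * z ^ 2) * min 1 (|x| ^ 2) := by
  rcases le_or_gt |x| 1 with h | h
  · have h1 : |x| ^ 2 ≤ 1 := pow_le_one₀ (abs_nonneg x) h
    rw [min_eq_right h1, sq_abs]
    have h2 : sinCompensated z x = (Complex.exp (Complex.I * z * x) - 1 - Complex.I * z * x)
        + Complex.I * z * ((x - Real.sin x : ℝ) : ℂ) := by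
      unfold sinCompensated
      push_cast
      ring
    have h3 : ‖Complex.I * z * ((x - Real.sin x : ℝ) : ℂ)‖ ≤ |z| * x ^ 2 := by
      rw [norm_mul, norm_mul, Complex.norm_I, one_mul, Complex.norm_real, Complex.norm_real]
      exact mul_le_mul_of_nonneg_left (abs_sub_sin_le h) (abs_nonneg z)
    rw [h2]
    refine (norm_add_le _ _).trans ?_
    have := norm_exp_sub_one_sub_le z x
    nlinarith [sq_nonneg x]
  · have h1 : 1 ≤ |x| ^ 2 := one_le_pow₀ h.le
    rw [min_eq_left h1]
    have h3 : ‖Complex.I * z * (Real.sin x : ℂ)‖ ≤ |z| := by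
      rw [norm_mul, norm_mul, Complex.norm_I, one_mul, Complex.norm_real, Complex.norm_real]
      exact mul_le_of_le_one_right (abs_nonneg z) (Real.abs_sin_le_one x)
    calc _ ≤ ‖Complex.exp (Complex.I * z * x)‖ + ‖(1 : ℂ)‖ + ‖Complex.I * z * (Real.sin x : ℂ)‖ :=
        (norm_sub_le _ _).trans (add_le_add_left (norm_sub_le _ _) _)
      _ ≤ 2 + |z| := by rw [norm_exp_I_mul_mul, norm_one]; linarith
      _ ≤ _ := by nlinarith [sq_nonneg z]

/-- The kernel `(e^{izx} - 1 - iz sin x) / (1 - sin x / x)`, extended continuously to `x = 0`. -/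
noncomputable def levyKernel (z x : ℝ) : ℂ :=
  if x = 0 then -3 * (z : ℂ) ^ 2 else sinCompensated z x / levyWeight x

@[simp] theorem levyKernel_zero (z : ℝ) : levyKernel z 0 = -3 * (z : ℂ) ^ 2 := if_pos rfl

theorem levyKernel_of_ne {x : ℝ} (hx : x ≠ 0) (z : ℝ) :
    levyKernel z x = sinCompensated z x / levyWeight x := if_neg hx

theorem sinCompensated_zero (z : ℝ) : sinCompensated z 0 = 0 := by simp [sinCompensated]

theorem levyKernel_mul_levyWeight (z x : ℝ) : levyKernel z x * levyWeight x = sinCompensated z x := by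
  rcases eq_or_ne x 0 with rfl | h0
  · simp [sinCompensated_zero]
  · rw [levyKernel_of_ne h0, div_mul_cancel₀]
    exact_mod_cast (levyWeight_pos h0).ne'

theorem norm_levyKernel_le (z x : ℝ) : ‖levyKernel z x‖ ≤ 40 * (2 + |z| + 3 * z ^ 2) := by
  rcases eq_or_ne x 0 with rfl | h0
  · simp
    nlinarith [abs_nonneg z, sq_nonneg z]
  · have hw := levyWeight_pos h0
    rw [levyKernel_of_ne h0, norm_div, Complex.norm_real, Real.norm_of_nonneg hw.le, div_le_iff₀ hw]
    calc _ ≤ _ := norm_sinCompensated_le z x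
      _ ≤ (2 + |z| + 3 * z ^ 2) * (40 * levyWeight x) :=
        mul_le_mul_of_nonneg_left (min_le_levyWeight x) (by positivity)
      _ = _ := by ring

theorem norm_sinCompensated_add_le {z x : ℝ} (hx : |x| ≤ 1) (hzx : |z * x| ≤ 1) :
    ‖sinCompensated z x + (z : ℂ) ^ 2 * x ^ 2 / 2‖ ≤ (|z| ^ 3 + |z|) * |x| ^ 3 := by
  have hn : ‖Complex.I * z * x‖ = |z * x| := by simp [abs_mul]
  have h1 := Complex.exp_bound (hn.trans_le hzx) (n := 3) (by norm_num)
  simp only [Finset.sum_range_succ, Finset.sum_range_zero, pow_zero, Nat.factorial, pow_one] at h1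
  rw [hn] at h1
  have h2 : sinCompensated z x + (z : ℂ) ^ 2 * x ^ 2 / 2
      = (Complex.exp (Complex.I * z * x) - (1 + Complex.I * z * x + (Complex.I * z * x) ^ 2 / 2))
        + Complex.I * z * ((x - Real.sin x : ℝ) : ℂ) := by
    unfold sinCompensated
    have : (Complex.I * z * x) ^ 2 = -((z : ℂ) ^ 2 * x ^ 2) := by
      rw [mul_pow, mul_pow, Complex.I_sq]
      ring
    rw [this]
    push_cast
    ring
  have h3 : ‖Complex.I * z * ((x - Real.sin x : ℝ) : ℂ)‖ ≤ |z| * |x| ^ 3 := by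
    rw [norm_mul, norm_mul, Complex.norm_I, one_mul, Complex.norm_real, Complex.norm_real]
    refine mul_le_mul_of_nonneg_left ?_ (abs_nonneg z)
    rcases eq_or_ne x 0 with rfl | h0
    · simp
    rw [← mul_levyWeight h0, norm_mul, Real.norm_eq_abs, Real.norm_of_nonneg (levyWeight_nonneg x)]
    calc |x| * levyWeight x ≤ |x| * x ^ 2 :=
          mul_le_mul_of_nonneg_left (levyWeight_le_sq hx) (abs_nonneg x)
      _ = |x| ^ 3 := by rw [← sq_abs x]; ring
  rw [h2]
  refine (norm_add_le _ _).trans ?_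
  rw [add_mul]
  refine add_le_add ?_ h3
  norm_num at h1
  refine h1.trans ?_
  rw [← abs_mul, ← mul_pow, ← abs_mul]
  nlinarith [pow_nonneg (abs_nonneg (z * x)) 3]

/-- Numerator and denominator are `-z²x²/2` and `x²/6` up to `O(|x|³)`, whence the value `-3z²` at
0. The factor `96/11` in the estimate inverts the lower bound `(11/96) x²` for the weight. -/
theorem continuousAt_levyKernel_zero (z : ℝ) : ContinuousAt (levyKernel z) 0 := by
  rw [ContinuousAt, tendsto_iff_norm_sub_tendsto_zero]
  have hev : ∀ᶠ x in 𝓝 (0 : ℝ), |x| ≤ 1 ∧ |z * x| ≤ 1 := by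
    have h1 : Tendsto (fun x : ℝ => |x|) (𝓝 0) (𝓝 0) := by
      have : Continuous fun x : ℝ => |x| := by fun_prop
      simpa using this.tendsto 0
    have h2 : Tendsto (fun x : ℝ => |z * x|) (𝓝 0) (𝓝 0) := by
      have : Continuous fun x : ℝ => |z * x| := by fun_prop
      simpa using this.tendsto 0
    exact (h1.eventually (ge_mem_nhds one_pos)).and (h2.eventually (ge_mem_nhds one_pos))
  have hbd : ∀ᶠ x in 𝓝 (0 : ℝ),
      ‖levyKernel z x - levyKernel z 0‖ ≤ (96 / 11 * (|z| ^ 3 + |z| + 3 * z ^ 2)) * |x| := by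
    filter_upwards [hev] with x hx
    rcases eq_or_ne x 0 with rfl | h0
    · simp
    have hw := levyWeight_pos h0
    have hwc : (levyWeight x : ℂ) ≠ 0 := by exact_mod_cast hw.ne'
    have h1 : levyKernel z x - levyKernel z 0 = ((sinCompensated z x + (z : ℂ) ^ 2 * x ^ 2 / 2)
        + 3 * (z : ℂ) ^ 2 * ((levyWeight x - x ^ 2 / 6 : ℝ) : ℂ)) / levyWeight x := by
      rw [levyKernel_of_ne h0, levyKernel_zero]
      field_simp
      push_cast
      ring
    have h2 : ‖3 * (z : ℂ) ^ 2 * ((levyWeight x - x ^ 2 / 6 : ℝ) : ℂ)‖ ≤ 3 * z ^ 2 * |x| ^ 3 := by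
      rw [norm_mul, norm_mul, norm_pow, Complex.norm_real, Complex.norm_real, Real.norm_eq_abs,
        sq_abs, Real.norm_eq_abs]
      norm_num
      have := abs_levyWeight_sub_le hx.1
      have h5 : |levyWeight x - x ^ 2 / 6| ≤ |x| ^ 3 := by
        nlinarith [pow_nonneg (abs_nonneg x) 3]
      exact mul_le_mul_of_nonneg_left h5 (by positivity)
    rw [h1, norm_div, Complex.norm_real, Real.norm_of_nonneg hw.le, div_le_iff₀ hw]
    have h3 := mul_sq_le_levyWeight hx.1
    have h4 : (96 / 11 * (|z| ^ 3 + |z| + 3 * z ^ 2)) * |x| * (11 / 96 * x ^ 2)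
        ≤ (96 / 11 * (|z| ^ 3 + |z| + 3 * z ^ 2)) * |x| * levyWeight x :=
      mul_le_mul_of_nonneg_left h3 (by positivity)
    refine ((norm_add_le _ _).trans (add_le_add (norm_sinCompensated_add_le hx.1 hx.2) h2)).trans ?_
    refine le_trans (le_of_eq ?_) h4
    rw [← sq_abs x]
    ring
  refine squeeze_zero' (.of_forall fun _ => norm_nonneg _) hbd ?_
  have : Continuous fun x : ℝ => (96 / 11 * (|z| ^ 3 + |z| + 3 * z ^ 2)) * |x| := by fun_prop
  simpa using this.tendsto 0

theorem continuous_sinCompensated (z : ℝ) : Continuous (sinCompensated z) := by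
  unfold sinCompensated
  fun_prop

theorem continuous_levyKernel (z : ℝ) : Continuous (levyKernel z) := by
  rw [continuous_iff_continuousAt]
  intro x
  rcases eq_or_ne x 0 with rfl | h0
  · exact continuousAt_levyKernel_zero z
  · have h1 : ContinuousAt (fun x => sinCompensated z x / levyWeight x) x := by
      refine (continuous_sinCompensated z).continuousAt.div ?_ ?_
      · exact (Complex.continuous_ofReal.comp continuous_levyWeight).continuousAt
      · exact_mod_cast (levyWeight_pos h0).ne'
    refine h1.congr ?_
    filter_upwards [isOpen_ne.mem_nhds h0] with y hy
    exact (levyKernel_of_ne hy z).symm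

theorem measurable_levyKernel : Measurable (Function.uncurry levyKernel) := by
  have h1 : Measurable fun p : ℝ × ℝ => sinCompensated p.1 p.2 := by
    unfold sinCompensated
    fun_prop
  have h2 : Measurable fun p : ℝ × ℝ => (levyWeight p.2 : ℂ) := by
    have := continuous_levyWeight
    fun_prop
  exact Measurable.ite (measurable_snd (measurableSet_singleton 0)) (by fun_prop) (h1.div h2)

theorem integral_exp_I_mul_add (z x : ℝ) :
    ∫ u in (-1 : ℝ)..1, Complex.exp (Complex.I * (z + u : ℝ) * x)
      = 2 * Complex.exp (Complex.I * z * x) * Real.sinc x := by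
  have h1 : ∀ u : ℝ, Complex.exp (Complex.I * (z + u : ℝ) * x)
      = Complex.exp (Complex.I * z * x) * Complex.exp (u * x * Complex.I) := by
    intro u
    rw [← Complex.exp_add]
    congr 1
    push_cast
    ring
  simp_rw [h1]
  rw [intervalIntegral.integral_const_mul]
  rcases eq_or_ne x 0 with rfl | h0
  · norm_num
  have h2 := intervalIntegral.integral_comp_mul_right (a := (-1 : ℝ)) (b := 1)
    (fun y : ℝ => Complex.exp (y * Complex.I)) h0
  have h3 := integral_exp_mul_I_eq_sinc x
  simp only [neg_one_mul, one_mul] at h2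
  rw [h3] at h2
  push_cast at h2
  rw [h2]
  have : (x : ℂ) ≠ 0 := by exact_mod_cast h0
  simp only [Complex.real_smul]
  push_cast
  field_simp

/-- Averaging over `[-1, 1]` fixes affine functions of `z` and multiplies `e^{izx}` by `sinc x`.
Subtracting the average therefore kills the compensator and produces exactly the factor `1 - sinc x`
in the denominator of the kernel. -/
theorem levyKernel_sub_average (z x : ℝ) :
    levyKernel z x - (1 / 2 : ℂ) * ∫ u in (-1 : ℝ)..1, levyKernel (z + u) x
      = Complex.exp (Complex.I * z * x) := by
  rcases eq_or_ne x 0 with rfl | h0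
  · have : ∫ u in (-1 : ℝ)..1, (z + u) ^ 2 = 2 * z ^ 2 + 2 / 3 := by
      rw [intervalIntegral.integral_comp_add_left (fun u => u ^ 2), integral_pow]
      norm_num
      ring
    simp only [levyKernel_zero]
    rw [intervalIntegral.integral_const_mul]
    have h2 : ∫ u in (-1 : ℝ)..1, ((z + u : ℝ) : ℂ) ^ 2 = ((2 * z ^ 2 + 2 / 3 : ℝ) : ℂ) := by
      rw [← this, ← intervalIntegral.integral_ofReal]
      simp
    rw [h2]
    push_cast
    simp
    ring
  · have hwc : (levyWeight x : ℂ) ≠ 0 := by exact_mod_cast (levyWeight_pos h0).ne'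
    simp only [levyKernel_of_ne h0]
    rw [intervalIntegral.integral_div]
    have h1 : ∫ u in (-1 : ℝ)..1, sinCompensated (z + u) x
        = 2 * Complex.exp (Complex.I * z * x) * Real.sinc x - 2
          - 2 * (Complex.I * z * Real.sin x) := by
      unfold sinCompensated
      have hlin : ∫ u in (-1 : ℝ)..1, Complex.I * (z + u : ℝ) * (Real.sin x : ℂ)
          = 2 * (Complex.I * z * Real.sin x) := by
        rw [intervalIntegral.integral_mul_const, intervalIntegral.integral_const_mul,
          intervalIntegral.integral_ofReal,
          intervalIntegral.integral_comp_add_left (fun u => u), integral_id]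
        push_cast
        ring
      rw [intervalIntegral.integral_sub, intervalIntegral.integral_sub, integral_exp_I_mul_add, hlin]
      · norm_num
      all_goals exact Continuous.intervalIntegrable (by fun_prop) _ _
    rw [h1]
    have hw : (levyWeight x : ℂ) = 1 - Real.sinc x := by
      simp [levyWeight]
    unfold sinCompensated
    field_simp
    rw [hw]
    ring

/-! ### Canonical exponents and their inversion -/

/-- The exponent `icz + ∫ (e^{izx} - 1 - iz sin x) / (1 - sin x / x) M(dx)` with drift `c` and
canonical finite measure `M`. -/
noncomputable def canonicalExponent (c : ℝ) (M : Measure ℝ) (z : ℝ) : ℂ :=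
  Complex.I * c * z + ∫ x, levyKernel z x ∂M

theorem integrable_levyKernel (M : Measure ℝ) [IsFiniteMeasure M] (z : ℝ) :
    Integrable (levyKernel z) M :=
  Integrable.of_bound (continuous_levyKernel z).aestronglyMeasurable _
    (.of_forall (norm_levyKernel_le z))

theorem continuous_sinCompensated_left (x : ℝ) : Continuous fun z => sinCompensated z x := by
  unfold sinCompensated
  fun_prop

theorem continuous_levyKernel_left (x : ℝ) : Continuous fun z => levyKernel z x := by
  unfold levyKernel
  split_ifs
  · fun_prop
  · exact (continuous_sinCompensated_left x).div_const _

theorem continuous_canonicalExponent (c : ℝ) (M : Measure ℝ) [IsFiniteMeasure M] :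
    Continuous (canonicalExponent c M) := by
  refine Continuous.add (by fun_prop) ?_
  rw [continuous_iff_continuousAt]
  intro z₀
  refine continuousAt_of_dominated (bound := fun _ => 40 * (2 + (|z₀| + 1) + 3 * (|z₀| + 1) ^ 2))
    (.of_forall fun z => (continuous_levyKernel z).aestronglyMeasurable) ?_ (integrable_const _)
    (.of_forall fun x => (continuous_levyKernel_left x).continuousAt)
  filter_upwards [Metric.ball_mem_nhds z₀ one_pos] with z hz
  refine .of_forall fun x => (norm_levyKernel_le z x).trans ?_
  have h1 : |z| ≤ |z₀| + 1 := by
    have : |z - z₀| < 1 := hz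
    have := abs_sub_abs_le_abs_sub z z₀
    linarith
  have h2 : z ^ 2 ≤ (|z₀| + 1) ^ 2 := by
    rw [← sq_abs z]
    exact pow_le_pow_left₀ (abs_nonneg z) h1 2
  linarith

@[simp] theorem canonicalExponent_zero (c : ℝ) (M : Measure ℝ) : canonicalExponent c M 0 = 0 := by
  have : ∀ x, levyKernel 0 x = 0 := by
    intro x
    unfold levyKernel sinCompensated
    split_ifs <;> simp
  simp [canonicalExponent, this]

/-- Fubini reduces this to the pointwise identity for the kernel. It recovers `M` from the exponent
by an operation that passes to limits. -/
theorem canonicalExponent_sub_average (c : ℝ) (M : Measure ℝ) [IsFiniteMeasure M] (z : ℝ) :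
    canonicalExponent c M z - (1 / 2 : ℂ) * ∫ u in (-1 : ℝ)..1, canonicalExponent c M (z + u)
      = charFun M z := by
  have hK : Continuous fun z => ∫ x, levyKernel z x ∂M := by
    have := continuous_canonicalExponent c M
    have h2 : (fun z => ∫ x, levyKernel z x ∂M)
        = fun z => canonicalExponent c M z - Complex.I * c * z := by
      ext z
      simp [canonicalExponent]
    rw [h2]
    fun_prop
  have hlin : ∫ u in (-1 : ℝ)..1, Complex.I * c * (z + u : ℝ) = 2 * (Complex.I * c * z) := by
    rw [intervalIntegral.integral_const_mul,
      intervalIntegral.integral_ofReal,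
      intervalIntegral.integral_comp_add_left (fun u => u), integral_id]
    push_cast
    ring
  have hswap : ∫ u in (-1 : ℝ)..1, ∫ x, levyKernel (z + u) x ∂M
      = ∫ x, (∫ u in (-1 : ℝ)..1, levyKernel (z + u) x) ∂M := by
    refine intervalIntegral_integral_swap ?_
    have hm : Measurable (Function.uncurry fun u x => levyKernel (z + u) x) :=
      measurable_levyKernel.comp (by fun_prop : Measurable fun p : ℝ × ℝ => (z + p.1, p.2))
    have : IsFiniteMeasure ((volume : Measure ℝ).restrict (Set.uIoc (-1) 1)) := by
      rw [Set.uIoc_of_le (by norm_num)]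
      infer_instance
    refine Integrable.of_bound hm.aestronglyMeasurable
      (40 * (2 + (|z| + 1) + 3 * (|z| + 1) ^ 2)) ?_
    have : ∀ᵐ p : ℝ × ℝ ∂(volume.restrict (Set.uIoc (-1 : ℝ) 1)).prod M, p.1 ∈ Set.uIoc (-1 : ℝ) 1 :=
      (Measure.quasiMeasurePreserving_fst (ν := M)).ae
        (ae_restrict_mem measurableSet_uIoc)
    filter_upwards [this] with p hp
    refine (norm_levyKernel_le _ _).trans ?_
    rw [Set.uIoc_of_le (by norm_num)] at hp
    have h0 : |p.1| ≤ 1 := abs_le.2 ⟨hp.1.le, hp.2⟩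
    have h1 : |z + p.1| ≤ |z| + 1 := (abs_add_le _ _).trans (by linarith)
    have h2 : (z + p.1) ^ 2 ≤ (|z| + 1) ^ 2 := by
      rw [← sq_abs (z + p.1)]
      exact pow_le_pow_left₀ (abs_nonneg _) h1 2
    linarith
  have hsum : ∫ u in (-1 : ℝ)..1, canonicalExponent c M (z + u)
      = 2 * (Complex.I * c * z) + ∫ x, (∫ u in (-1 : ℝ)..1, levyKernel (z + u) x) ∂M := by
    unfold canonicalExponent
    rw [intervalIntegral.integral_add, hlin, hswap]
    · exact Continuous.intervalIntegrable (by fun_prop) _ _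
    · exact (hK.comp (by fun_prop : Continuous fun u => z + u)).intervalIntegrable _ _
  have hint : Integrable (fun x => (1 / 2 : ℂ) * ∫ u in (-1 : ℝ)..1, levyKernel (z + u) x) M := by
    have : (fun x : ℝ => (1 / 2 : ℂ) * ∫ u in (-1 : ℝ)..1, levyKernel (z + u) x)
        = fun x : ℝ => levyKernel z x - Complex.exp (Complex.I * z * x) := by
      ext x
      rw [← levyKernel_sub_average z x]
      ring
    rw [this]
    refine (integrable_levyKernel M z).sub (Integrable.of_bound (by fun_prop) 1
      (.of_forall fun x => (norm_exp_I_mul_mul z x).le))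
  rw [hsum, charFun_apply_real, mul_add, canonicalExponent, ← integral_const_mul]
  calc _ = (∫ x, levyKernel z x ∂M)
        - ∫ x, ((1 / 2 : ℂ) * ∫ u in (-1 : ℝ)..1, levyKernel (z + u) x) ∂M := by ring
    _ = ∫ x, (levyKernel z x - (1 / 2 : ℂ) * ∫ u in (-1 : ℝ)..1, levyKernel (z + u) x) ∂M :=
        (integral_sub (integrable_levyKernel M z) hint).symm
    _ = _ := by
        refine integral_congr_ae (.of_forall fun x => ?_)
        simp only
        rw [levyKernel_sub_average]
        congr 1
        ring

/-- Uniqueness of drift and canonical measure. -/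
theorem canonicalExponent_injective {c c' : ℝ} {M M' : Measure ℝ} [IsFiniteMeasure M]
    [IsFiniteMeasure M'] (h : ∀ z, canonicalExponent c M z = canonicalExponent c' M' z) :
    c = c' ∧ M = M' := by
  have hM : M = M' := by
    refine Measure.ext_of_charFun (funext fun z => ?_)
    rw [← canonicalExponent_sub_average c M, ← canonicalExponent_sub_average c' M']
    simp_rw [h]
  subst hM
  refine ⟨?_, rfl⟩
  have := h 1
  unfold canonicalExponent at this
  simpa using this

/-! ### Weighted measures, compound Poisson laws, existence for canonical exponents -/

/-- The measure `w dμ` for a nonnegative weight `w`. -/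
noncomputable def weighted (w : ℝ → ℝ) (μ : Measure ℝ) : Measure ℝ :=
  μ.withDensity fun x => ENNReal.ofReal (w x)

/-- The measure `1_{x ≠ 0} w⁻¹ dM`. -/
noncomputable def unweighted (w : ℝ → ℝ) (M : Measure ℝ) : Measure ℝ :=
  (M.restrict {0}ᶜ).withDensity fun x => (ENNReal.ofReal (w x))⁻¹

theorem integral_weighted {w : ℝ → ℝ} (hw : Measurable w) {μ : Measure ℝ}
    (h0 : ∀ᵐ x ∂μ, 0 ≤ w x) (g : ℝ → ℂ) :
    ∫ x, g x ∂(weighted w μ) = ∫ x, g x * w x ∂μ := by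
  rw [weighted, integral_withDensity_eq_integral_toReal_smul (by fun_prop) (by simp)]
  refine integral_congr_ae ?_
  filter_upwards [h0] with x hx
  rw [ENNReal.toReal_ofReal hx, Complex.real_smul, mul_comm]

theorem isFiniteMeasure_weighted {w : ℝ → ℝ} {μ : Measure ℝ}
    (h : ∫⁻ x, ENNReal.ofReal (w x) ∂μ < ⊤) : IsFiniteMeasure (weighted w μ) :=
  isFiniteMeasure_withDensity h.ne

theorem unweighted_weighted {w : ℝ → ℝ} (hw : Measurable w) {μ : Measure ℝ} (h0 : μ {0} = 0)
    (hpos : ∀ᵐ x ∂μ, x ≠ 0 → 0 < w x) : unweighted w (weighted w μ) = μ := by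
  have hr : μ.restrict {0}ᶜ = μ := by
    rw [Measure.restrict_eq_self_of_ae_mem]
    exact compl_mem_ae_iff.2 h0
  have hne : ∀ᵐ x ∂μ, x ≠ 0 := compl_mem_ae_iff.2 h0
  rw [unweighted, weighted, restrict_withDensity (measurableSet_singleton 0).compl, hr]
  refine withDensity_inv_same (by fun_prop) ?_ (by simp)
  filter_upwards [hpos, hne] with x h1 h2
  simpa using h1 h2

theorem weighted_unweighted {w : ℝ → ℝ} (hw : Measurable w) {M : Measure ℝ}
    (hpos : ∀ᵐ x ∂M, x ≠ 0 → 0 < w x) : weighted w (unweighted w M) = M.restrict {0}ᶜ := by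
  have h1 : ∀ᵐ x ∂(M.restrict {0}ᶜ), 0 < w x := by
    filter_upwards [ae_restrict_of_ae hpos, ae_restrict_mem (measurableSet_singleton 0).compl]
      with x h1 h2 using h1 h2
  rw [unweighted, weighted]
  have h2 := withDensity_inv_same (μ := M.restrict {0}ᶜ)
    (f := fun x => (ENNReal.ofReal (w x))⁻¹) (by fun_prop) (by simp) ?_
  · convert! h2 using 2
    ext x
    simp
  · filter_upwards [h1] with x hx
    simpa using hx

theorem unweighted_singleton_zero (w : ℝ → ℝ) (M : Measure ℝ) : unweighted w M {0} = 0 := by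
  rw [unweighted, withDensity_apply _ (measurableSet_singleton 0),
    Measure.restrict_restrict (measurableSet_singleton 0)]
  simp

theorem charFun_smul_measure {a : ℝ} (ha : 0 ≤ a) (μ : Measure ℝ) (t : ℝ) :
    charFun (ENNReal.ofReal a • μ) t = a * charFun μ t := by
  rw [charFun_apply, charFun_apply, integral_smul_measure, ENNReal.toReal_ofReal ha,
    Complex.real_smul]

theorem charFun_add_measure (μ ν : Measure ℝ) [IsFiniteMeasure μ] [IsFiniteMeasure ν] (t : ℝ) :
    charFun (μ + ν) t = charFun μ t + charFun ν t := by
  have hi : ∀ η : Measure ℝ, IsFiniteMeasure η →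
      Integrable (fun x : ℝ => Complex.exp (t * x * Complex.I)) η := fun η _ => by
    refine Integrable.of_bound (by fun_prop) 1 (.of_forall fun x => ?_)
    rw [← Complex.ofReal_mul, Complex.norm_exp_ofReal_mul_I]
  simp only [charFun_apply_real]
  exact integral_add_measure (hi μ inferInstance) (hi ν inferInstance)

theorem conv_Iio_eq_zero {μ ν : Measure ℝ} [IsFiniteMeasure μ] [IsFiniteMeasure ν]
    (hμ : μ (Set.Iio 0) = 0) (hν : ν (Set.Iio 0) = 0) : Measure.conv μ ν (Set.Iio 0) = 0 := by
  rw [Measure.conv, Measure.map_apply (by fun_prop) measurableSet_Iio]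
  have h1 : ∀ᵐ p : ℝ × ℝ ∂(μ.prod ν), 0 ≤ p.1 := by
    refine (Measure.quasiMeasurePreserving_fst (ν := ν)).ae (p := fun x => 0 ≤ x) ?_
    simpa [ae_iff, Set.Iio] using hμ
  have h2 : ∀ᵐ p : ℝ × ℝ ∂(μ.prod ν), 0 ≤ p.2 := by
    refine (Measure.quasiMeasurePreserving_snd (μ := μ)).ae (p := fun x => 0 ≤ x) ?_
    simpa [ae_iff, Set.Iio] using hν
  rw [measure_eq_zero_iff_ae_notMem]
  filter_upwards [h1, h2] with p hp1 hp2
  simpa using add_nonneg hp1 hp2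

theorem convIter_Iio_eq_zero {ν : Measure ℝ} (hν : IsProbabilityMeasure ν)
    (h : ν (Set.Iio 0) = 0) (n : ℕ) : convIter ν n (Set.Iio 0) = 0 := by
  induction n with
  | zero => simp [convIter]
  | succ n ih =>
    have := (convIter_spec hν n).1
    exact conv_Iio_eq_zero ih h

/-- Existence of compound Poisson laws. -/
theorem exists_compoundPoisson (μ : Measure ℝ) [IsFiniteMeasure μ] :
    ∃ P : Measure ℝ, IsProbabilityMeasure P ∧
      (∀ z, charFun P z = Complex.exp (charFun μ z - charFun μ 0)) ∧
      (μ (Set.Iio 0) = 0 → P (Set.Iio 0) = 0) := by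
  -- Starting at `k ≥ N` keeps the mass `1 - μ(ℝ)/k` left at 0 nonnegative.
  obtain ⟨N, hN⟩ := exists_nat_gt (μ.real Set.univ)
  have hNpos : (0 : ℝ) < N := measureReal_nonneg.trans_lt hN
  let k : ℕ → ℕ := fun n => n + N
  have hk : ∀ n, (0 : ℝ) < k n := fun n => by
    simp only [k]
    push_cast
    positivity
  have hkm : ∀ n, 0 ≤ 1 - μ.real Set.univ / k n := fun n => by
    rw [sub_nonneg, div_le_one (hk n)]
    simp only [k]
    push_cast
    linarith [(Nat.cast_nonneg n : (0 : ℝ) ≤ n)]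
  -- The `k`-fold convolution power of `(1 - μ(ℝ)/k) δ₀ + μ/k` has characteristic function `(1 +
  -- ψ/k)^k → e^ψ`, with `ψ = charFun μ - charFun μ 0`.
  let Q : ℕ → Measure ℝ := fun n => ENNReal.ofReal (1 - μ.real Set.univ / k n) • Measure.dirac 0
    + ENNReal.ofReal (k n)⁻¹ • μ
  have hfin1 : ∀ (a : ℝ) (η : Measure ℝ), IsFiniteMeasure η → IsFiniteMeasure (ENNReal.ofReal a • η) :=
    fun a η _ => Measure.smul_finite η ENNReal.ofReal_ne_top
  have hQc : ∀ n t, charFun (Q n) t = 1 + (charFun μ t - charFun μ 0) / k n := by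
    intro n t
    have := hfin1 (1 - μ.real Set.univ / k n) (Measure.dirac 0) inferInstance
    have := hfin1 (k n)⁻¹ μ inferInstance
    rw [charFun_add_measure, charFun_smul_measure (hkm n),
      charFun_smul_measure (inv_nonneg.2 (hk n).le), charFun_dirac, charFun_zero]
    simp
    ring
  have hQ : ∀ n, IsProbabilityMeasure (Q n) := by
    intro n
    refine ⟨?_⟩
    simp only [Q, Measure.add_apply, Measure.smul_apply, measure_univ, smul_eq_mul, mul_one]
    rw [← ofReal_measureReal (μ := μ) (s := Set.univ), ← ENNReal.ofReal_mul (inv_nonneg.2 (hk n).le),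
      ← ENNReal.ofReal_add (hkm n) (by positivity [(hk n).le])]
    rw [show 1 - μ.real Set.univ / k n + (k n : ℝ)⁻¹ * μ.real Set.univ = 1 by ring]
    simp
  obtain ⟨P, hP, hPc, hPU⟩ := exists_prob_of_tendsto_charFun
    (μ := fun n => convIter (Q n) (k n)) (g := fun z => Complex.exp (charFun μ z - charFun μ 0))
    (fun n => (convIter_spec (hQ n) _).1)
    (by have := continuous_charFun (μ := μ); fun_prop) (fun t => by
      simp_rw [(convIter_spec (hQ _) _).2, hQc]
      exact (Complex.tendsto_one_add_div_pow_exp (charFun μ t - charFun μ 0)).comp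
        (tendsto_add_atTop_nat N))
  refine ⟨P, hP, hPc, fun h => hPU _ isOpen_Iio fun n => convIter_Iio_eq_zero (hQ n) ?_ _⟩
  simp [Q, h]

/-- The kernel times the weight is `e^{izx} - 1 - iz sin x`, and the drift `∫ sin dμ` cancels the
compensator. Compound Poisson exponents are thus canonical. -/
theorem canonicalExponent_weighted (μ : Measure ℝ) [IsFiniteMeasure μ] (z : ℝ) :
    canonicalExponent (∫ x, Real.sin x ∂μ) (weighted levyWeight μ) z = charFun μ z - charFun μ 0 := by
  rw [canonicalExponent, integral_weighted continuous_levyWeight.measurable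
    (.of_forall levyWeight_nonneg)]
  simp_rw [levyKernel_mul_levyWeight]
  have h1 : Integrable (fun x : ℝ => Complex.exp (Complex.I * z * x)) μ :=
    Integrable.of_bound (by fun_prop) 1 (.of_forall fun x => (norm_exp_I_mul_mul z x).le)
  have h2 : Integrable (fun x : ℝ => (Real.sin x : ℂ)) μ :=
    Integrable.of_bound (by fun_prop) 1 (.of_forall fun x => by
      rw [Complex.norm_real]
      exact Real.abs_sin_le_one x)
  have h3 : ∫ x, sinCompensated z x ∂μ = (∫ x : ℝ, Complex.exp (Complex.I * z * x) ∂μ)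
      - (∫ x : ℝ, (1 : ℂ) ∂μ) - Complex.I * z * ∫ x, (Real.sin x : ℂ) ∂μ := by
    have h5 : Integrable (fun x : ℝ => Complex.exp (Complex.I * z * x) - 1) μ :=
      h1.sub (integrable_const _)
    unfold sinCompensated
    rw [integral_sub h5 (h2.const_mul _), integral_sub h1 (integrable_const _), integral_const_mul]
  rw [h3, integral_complex_ofReal, charFun_zero, charFun_apply_real]
  have h4 : ∫ x : ℝ, Complex.exp (Complex.I * z * x) ∂μ
      = ∫ x : ℝ, Complex.exp (z * x * Complex.I) ∂μ := by
    congr 1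
    ext x
    congr 1
    ring
  rw [h4]
  simp
  ring

theorem measurable_levyWeight : Measurable levyWeight := continuous_levyWeight.measurable

/-- Every pair of a drift and a finite canonical measure belongs to a probability measure. -/
theorem exists_prob_canonicalExponent (c : ℝ) (M : Measure ℝ) [IsFiniteMeasure M] :
    ∃ P : Measure ℝ, IsProbabilityMeasure P ∧
      ∀ z, charFun P z = Complex.exp (canonicalExponent c M z) := by
  -- `T n` moves the mass near 0, including an atom at 0, to `1/(n+1)`. The image of `M` is then the
  -- weighting of a finite measure, and the Gaussian part arises as a limit of small jumps.
  let T : ℕ → ℝ → ℝ := fun n x => if |x| < 1 / ((n : ℝ) + 1) then 1 / ((n : ℝ) + 1) else x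
  have hε : ∀ n : ℕ, 0 < 1 / ((n : ℝ) + 1) := fun n => Nat.one_div_pos_of_nat
  have hT : ∀ n, Measurable (T n) := fun n =>
    Measurable.ite (measurableSet_lt (by fun_prop) (by fun_prop)) (by fun_prop) (by fun_prop)
  have hTge : ∀ (n : ℕ) x, 1 / ((n : ℝ) + 1) ≤ |T n x| := by
    intro n x
    simp only [T]
    split_ifs with h
    · exact le_abs_self _
    · exact not_lt.1 h
  have hTlim : ∀ x, Tendsto (fun n => T n x) atTop (𝓝 x) := by
    intro x
    rcases eq_or_ne x 0 with rfl | h0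
    · refine tendsto_one_div_add_atTop_nhds_zero_nat.congr fun n => ?_
      simp only [T]
      rw [if_pos (by simpa using hε n)]
    · refine tendsto_const_nhds.congr' ?_
      have := (tendsto_one_div_add_atTop_nhds_zero_nat (𝕜 := ℝ)).eventually
        (gt_mem_nhds (abs_pos.2 h0))
      filter_upwards [this] with n hn
      exact (if_neg (not_lt.2 hn.le)).symm
  have hMn : ∀ n, ∃ P : Measure ℝ, IsProbabilityMeasure P ∧
      ∀ z, charFun P z = Complex.exp (canonicalExponent c (M.map (T n)) z) := by
    intro n
    have hae : ∀ᵐ x ∂(M.map (T n)), 1 / ((n : ℝ) + 1) ≤ |x| := by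
      rw [ae_map_iff (hT n).aemeasurable (measurableSet_le (by fun_prop) (by fun_prop))]
      exact .of_forall (hTge n)
    have hne : ∀ᵐ x ∂(M.map (T n)), x ≠ 0 := by
      filter_upwards [hae] with x hx h0
      rw [h0, abs_zero] at hx
      exact absurd (hε n) (not_lt.2 hx)
    have hrs : (M.map (T n)).restrict {0}ᶜ = M.map (T n) :=
      Measure.restrict_eq_self_of_ae_mem hne
    have hw := weighted_unweighted measurable_levyWeight (M := M.map (T n))
      (.of_forall fun x => levyWeight_pos)
    rw [hrs] at hw
    set μ := unweighted levyWeight (M.map (T n)) with hμ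
    have hfin : IsFiniteMeasure μ := by
      refine isFiniteMeasure_withDensity ?_
      rw [hrs]
      have hδ : (0 : ℝ) < min 1 ((1 / ((n : ℝ) + 1)) ^ 2) / 40 := by
        have := hε n
        positivity
      refine ((lintegral_mono_ae (g := fun _ => (ENNReal.ofReal
        (min 1 ((1 / ((n : ℝ) + 1)) ^ 2) / 40))⁻¹) ?_).trans_lt ?_).ne
      · filter_upwards [hae] with x hx
        refine ENNReal.inv_le_inv.2 (ENNReal.ofReal_le_ofReal ?_)
        have h1 := min_le_levyWeight x
        have h2 : min 1 ((1 / ((n : ℝ) + 1)) ^ 2) ≤ min 1 (|x| ^ 2) :=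
          min_le_min_left _ (pow_le_pow_left₀ (hε n).le hx 2)
        linarith
      · rw [lintegral_const]
        exact ENNReal.mul_lt_top (by simpa using hδ) (measure_lt_top _ _)
    obtain ⟨P, hP, hPc, -⟩ := exists_compoundPoisson μ
    -- The point mass corrects the drift from `∫ sin dμ` to `c`.
    refine ⟨Measure.conv P (Measure.dirac (c - ∫ x, Real.sin x ∂μ)), inferInstance, fun z => ?_⟩
    have h1 := canonicalExponent_weighted μ z
    rw [hw] at h1
    rw [charFun_conv, hPc, ← h1, charFun_dirac, ← Complex.exp_add]
    congr 1
    unfold canonicalExponent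
    simp
    ring
  choose P hP hPc using hMn
  obtain ⟨Q, hQ, hQc, -⟩ := exists_prob_of_tendsto_charFun hP
    (g := fun z => Complex.exp (canonicalExponent c M z))
    (by have := continuous_canonicalExponent c M; fun_prop) (fun z => by
      simp_rw [hPc]
      refine (Complex.continuous_exp.tendsto _).comp (tendsto_const_nhds.add ?_)
      have h1 : ∀ n, ∫ x, levyKernel z x ∂(M.map (T n)) = ∫ x, levyKernel z (T n x) ∂M :=
        fun n => integral_map (hT n).aemeasurable (continuous_levyKernel z).aestronglyMeasurable
      simp_rw [h1]
      refine tendsto_integral_of_dominated_convergence (fun _ => 40 * (2 + |z| + 3 * z ^ 2))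
        (fun n => ((continuous_levyKernel z).measurable.comp (hT n)).aestronglyMeasurable)
        (integrable_const _) (fun n => .of_forall fun x => norm_levyKernel_le z _)
        (.of_forall fun x => ((continuous_levyKernel z).tendsto x).comp (hTlim x)))
  exact ⟨Q, hQ, hQc⟩

/-! ### Triplets versus canonical pairs -/

theorem measurable_trunc : Measurable trunc :=
  Measurable.ite (measurableSet_le (by fun_prop) (by fun_prop)) (by fun_prop) (by fun_prop)

theorem abs_sin_sub_trunc_le (x : ℝ) : |Real.sin x - trunc x| ≤ min 1 (|x| ^ 2) := by
  unfold trunc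
  split_ifs with h
  · rw [min_eq_right (pow_le_one₀ (abs_nonneg x) h), sq_abs, abs_sub_comm]
    exact abs_sub_sin_le h
  · rw [min_eq_left (one_le_pow₀ (not_le.1 h).le), sub_zero]
    exact Real.abs_sin_le_one x

theorem IsLevyMeasure.integrable {E : Type*} [NormedAddCommGroup E] {ν : Measure ℝ}
    (hν : IsLevyMeasure ν) {f : ℝ → E} (hf : AEStronglyMeasurable f ν) {C : ℝ}
    (h : ∀ x, ‖f x‖ ≤ C * min 1 (|x| ^ 2)) : Integrable f ν := by
  have h1 : Integrable (fun x : ℝ => min 1 (|x| ^ 2)) ν := by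
    refine ⟨by fun_prop, ?_⟩
    rw [hasFiniteIntegral_iff_ofReal (.of_forall fun x => by positivity)]
    exact hν.2
  exact (h1.const_mul C).mono' hf (.of_forall h)

/-- The canonical measure of `(b, ν)`. -/
noncomputable def canonicalMeasure (b : ℝ) (ν : Measure ℝ) : Measure ℝ :=
  weighted levyWeight ν + ENNReal.ofReal (b / 6) • Measure.dirac 0

/-- The drift relative to `sin` of the triplet `(γ, b, ν)`. -/
noncomputable def sinDrift (γ : ℝ) (ν : Measure ℝ) : ℝ := γ + ∫ x, (Real.sin x - trunc x) ∂ν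

theorem IsLevyMeasure.isFiniteMeasure_weighted {ν : Measure ℝ} (hν : IsLevyMeasure ν) :
    IsFiniteMeasure (weighted levyWeight ν) := by
  refine LevySub.isFiniteMeasure_weighted (lt_of_le_of_lt (lintegral_mono fun x =>
    ENNReal.ofReal_le_ofReal (levyWeight_le_min x)) ?_)
  simp_rw [ENNReal.ofReal_mul (zero_le_two (α := ℝ))]
  rw [lintegral_const_mul _ (by fun_prop)]
  exact ENNReal.mul_lt_top ENNReal.ofReal_lt_top hν.2

theorem IsLevyMeasure.isFiniteMeasure_canonicalMeasure {ν : Measure ℝ} (hν : IsLevyMeasure ν)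
    (b : ℝ) : IsFiniteMeasure (canonicalMeasure b ν) := by
  have := hν.isFiniteMeasure_weighted
  have := Measure.smul_finite (Measure.dirac (0 : ℝ)) (ENNReal.ofReal_ne_top (r := b / 6))
  unfold canonicalMeasure
  infer_instance

/-- The atom `b/6` at 0 contributes `-3z² · b/6 = -z²b/2`. Replacing `τ` by `sin` in the compensator
shifts the drift by a finite amount, since `|sin x - τ(x)| ≤ 1 ∧ x²`. -/
theorem levyExponent_eq_canonicalExponent {γ b : ℝ} (hb : 0 ≤ b) {ν : Measure ℝ}
    (hν : IsLevyMeasure ν) (z : ℝ) :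
    levyExponent γ b ν z = canonicalExponent (sinDrift γ ν) (canonicalMeasure b ν) z := by
  have := hν.isFiniteMeasure_weighted
  have := Measure.smul_finite (Measure.dirac (0 : ℝ)) (ENNReal.ofReal_ne_top (r := b / 6))
  have h1 : Integrable (sinCompensated z) ν :=
    hν.integrable (continuous_sinCompensated z).aestronglyMeasurable (norm_sinCompensated_le z)
  have h2 : Integrable (fun x => Real.sin x - trunc x) ν :=
    hν.integrable (C := 1) (Real.measurable_sin.sub measurable_trunc).aestronglyMeasurable
      fun x => by
        rw [one_mul]
        exact abs_sin_sub_trunc_le x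
  have h2' : Integrable (fun x => ((Real.sin x - trunc x : ℝ) : ℂ)) ν := h2.ofReal
  have h3 : (fun x : ℝ => Complex.exp (Complex.I * z * x) - 1 - Complex.I * trunc x * z)
      = fun x => sinCompensated z x + Complex.I * z * ((Real.sin x - trunc x : ℝ) : ℂ) := by
    ext x
    unfold sinCompensated
    push_cast
    ring
  have h4 : ∫ x, levyKernel z x ∂(weighted levyWeight ν) = ∫ x, sinCompensated z x ∂ν := by
    rw [integral_weighted measurable_levyWeight (.of_forall levyWeight_nonneg)]
    simp_rw [levyKernel_mul_levyWeight]
  unfold levyExponent canonicalExponent canonicalMeasure sinDrift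
  rw [h3, integral_add h1 (h2'.const_mul _), integral_const_mul, integral_complex_ofReal,
    integral_add_measure (integrable_levyKernel _ z) (integrable_levyKernel _ z), h4,
    integral_smul_measure, integral_dirac, levyKernel_zero, ENNReal.toReal_ofReal (by positivity),
    Complex.real_smul]
  push_cast
  ring

theorem canonicalMeasure_singleton_zero (b : ℝ) (ν : Measure ℝ) :
    canonicalMeasure b ν {0} = ENNReal.ofReal (b / 6) := by
  simp [canonicalMeasure, weighted, withDensity_apply]

/-- The atom at 0 gives `b`; dividing by the weight off 0 gives `ν`. -/
theorem canonicalMeasure_injective {b b' : ℝ} (hb : 0 ≤ b) (hb' : 0 ≤ b') {ν ν' : Measure ℝ}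
    (hν : ν {0} = 0) (hν' : ν' {0} = 0) (h : canonicalMeasure b ν = canonicalMeasure b' ν') :
    b = b' ∧ ν = ν' := by
  have h1 : b / 6 = b' / 6 := by
    rw [← ENNReal.ofReal_eq_ofReal_iff (by positivity) (by positivity),
      ← canonicalMeasure_singleton_zero b ν, h, canonicalMeasure_singleton_zero]
  have h2 : ∀ b ν, unweighted levyWeight (canonicalMeasure b ν)
      = unweighted levyWeight (weighted levyWeight ν) := by
    intro b ν
    have h3 : (Measure.dirac (0 : ℝ)).restrict {0}ᶜ = 0 := by simp
    unfold unweighted canonicalMeasure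
    rw [Measure.restrict_add, Measure.restrict_smul, h3, smul_zero, add_zero]
  refine ⟨by linarith, ?_⟩
  rw [← unweighted_weighted measurable_levyWeight hν (.of_forall fun x => levyWeight_pos), ← h2 b ν,
    h, h2, unweighted_weighted measurable_levyWeight hν' (.of_forall fun x => levyWeight_pos)]

theorem isLevyMeasure_unweighted (M : Measure ℝ) [IsFiniteMeasure M] :
    IsLevyMeasure (unweighted levyWeight M) := by
  refine ⟨unweighted_singleton_zero _ _, ?_⟩
  have h1 : ∫⁻ x, ENNReal.ofReal (levyWeight x) ∂(unweighted levyWeight M) = M {0}ᶜ := by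
    rw [← setLIntegral_univ, ← withDensity_apply _ MeasurableSet.univ]
    have := weighted_unweighted measurable_levyWeight (M := M) (.of_forall fun x => levyWeight_pos)
    rw [weighted] at this
    rw [this]
    simp
  calc _ ≤ ∫⁻ x, ENNReal.ofReal 40 * ENNReal.ofReal (levyWeight x) ∂(unweighted levyWeight M) := by
        refine lintegral_mono fun x => ?_
        rw [← ENNReal.ofReal_mul (by norm_num)]
        exact ENNReal.ofReal_le_ofReal (min_le_levyWeight x)
    _ < ⊤ := by
        have := measurable_levyWeight
        rw [lintegral_const_mul _ (by fun_prop), h1]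
        exact ENNReal.mul_lt_top ENNReal.ofReal_lt_top (measure_lt_top _ _)

theorem exists_levyExponent_eq (c : ℝ) (M : Measure ℝ) [IsFiniteMeasure M] :
    ∃ (γ b : ℝ) (ν : Measure ℝ), 0 ≤ b ∧ IsLevyMeasure ν ∧
      ∀ z, levyExponent γ b ν z = canonicalExponent c M z := by
  have hν := isLevyMeasure_unweighted M
  refine ⟨c - ∫ x, (Real.sin x - trunc x) ∂(unweighted levyWeight M), 6 * M.real {0},
    unweighted levyWeight M, by positivity, hν, fun z => ?_⟩
  rw [levyExponent_eq_canonicalExponent (by positivity) hν, sinDrift, sub_add_cancel]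
  congr 1
  rw [canonicalMeasure, weighted_unweighted measurable_levyWeight (.of_forall fun x => levyWeight_pos),
    mul_div_cancel_left₀ _ (by norm_num), ofReal_measureReal, ← Measure.restrict_singleton, add_comm,
    Measure.restrict_add_restrict_compl (measurableSet_singleton 0)]

theorem canonicalExponent_smul {s : ℝ} (hs : 0 ≤ s) (c : ℝ) (M : Measure ℝ) (z : ℝ) :
    canonicalExponent (s * c) (ENNReal.ofReal s • M) z = s * canonicalExponent c M z := by
  unfold canonicalExponent
  rw [integral_smul_measure, ENNReal.toReal_ofReal hs, Complex.real_smul]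
  push_cast
  ring

/-- Convolution powers with arbitrary exponent `s ≥ 0`. -/
theorem exists_prob_smul_canonicalExponent (c : ℝ) (M : Measure ℝ) [IsFiniteMeasure M] {s : ℝ}
    (hs : 0 ≤ s) : ∃ P : Measure ℝ, IsProbabilityMeasure P ∧
      ∀ z, charFun P z = Complex.exp (s * canonicalExponent c M z) := by
  have := Measure.smul_finite M (ENNReal.ofReal_ne_top (r := s))
  obtain ⟨P, hP, h⟩ := exists_prob_canonicalExponent (s * c) (ENNReal.ofReal s • M)
  exact ⟨P, hP, fun z => by rw [h, canonicalExponent_smul hs]⟩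

/-- The power with exponent `1/n` is an `n`-th root. -/
theorem mem_ID_of_charFun_eq {μ : Measure ℝ} (hμ : IsProbabilityMeasure μ) {c : ℝ} {M : Measure ℝ}
    [IsFiniteMeasure M] (h : ∀ z, charFun μ z = Complex.exp (canonicalExponent c M z)) : μ ∈ ID := by
  refine mem_ID_iff.2 ⟨hμ, fun n hn => ?_⟩
  obtain ⟨P, hP, hPc⟩ := exists_prob_smul_canonicalExponent c M (s := (n : ℝ)⁻¹) (by positivity)
  refine ⟨P, hP, fun t => ?_⟩
  rw [hPc, h, ← Complex.exp_nat_mul]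
  congr 1
  push_cast
  rw [mul_inv_cancel_left₀]
  exact_mod_cast (by lia : n ≠ 0)

theorem HasTriplet.mem_ID {μ : Measure ℝ} {γ b : ℝ} {ν : Measure ℝ} (h : HasTriplet μ γ b ν) :
    μ ∈ ID := by
  have := h.levy.isFiniteMeasure_canonicalMeasure b
  exact mem_ID_of_charFun_eq h.isProb fun z => by
    rw [h.charFun_eq, levyExponent_eq_canonicalExponent h.gauss_nonneg h.levy]

theorem exists_hasTriplet (γ : ℝ) {b : ℝ} (hb : 0 ≤ b) {ν : Measure ℝ} (hν : IsLevyMeasure ν) :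
    ∃ μ, HasTriplet μ γ b ν := by
  have := hν.isFiniteMeasure_canonicalMeasure b
  obtain ⟨P, hP, h⟩ := exists_prob_canonicalExponent (sinDrift γ ν) (canonicalMeasure b ν)
  exact ⟨P, hP, hb, hν, fun z => by rw [h, levyExponent_eq_canonicalExponent hb hν]⟩

/-- Exponents are continuous and vanish at 0, so the characteristic function determines them;
injectivity of the canonical form does the rest. -/
theorem HasTriplet.unique {μ : Measure ℝ} {γ b γ' b' : ℝ} {ν ν' : Measure ℝ}
    (h : HasTriplet μ γ b ν) (h' : HasTriplet μ γ' b' ν') : γ = γ' ∧ b = b' ∧ ν = ν' := by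
  have := h.levy.isFiniteMeasure_canonicalMeasure b
  have := h'.levy.isFiniteMeasure_canonicalMeasure b'
  have h1 := eq_of_exp_eq (continuous_canonicalExponent (sinDrift γ ν) (canonicalMeasure b ν))
    (continuous_canonicalExponent (sinDrift γ' ν') (canonicalMeasure b' ν')) (by simp) fun z => by
      rw [← levyExponent_eq_canonicalExponent h.gauss_nonneg h.levy, ← h.charFun_eq, h'.charFun_eq,
        levyExponent_eq_canonicalExponent h'.gauss_nonneg h'.levy]
  obtain ⟨h2, h3⟩ := canonicalExponent_injective fun z => congrFun h1 z
  obtain ⟨rfl, rfl⟩ := canonicalMeasure_injective h.gauss_nonneg h'.gauss_nonneg h.levy.1 h'.levy.1 h3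
  exact ⟨by simpa [sinDrift] using h2, rfl, rfl⟩

theorem HasTriplet.eq {μ η : Measure ℝ} {γ b : ℝ} {ν : Measure ℝ}
    (h : HasTriplet μ γ b ν) (h' : HasTriplet η γ b ν) : μ = η := by
  have := h.isProb
  have := h'.isProb
  exact Measure.ext_of_charFun (funext fun z => by rw [h.charFun_eq, h'.charFun_eq])

/-! ### The Lévy–Khintchine representation -/

theorem tendsto_integral_of_tendsto_finiteMeasure {M : ℕ → FiniteMeasure ℝ} {L : FiniteMeasure ℝ}
    (h : Tendsto M atTop (𝓝 L)) {g : ℝ → ℂ} (hg : Continuous g) {C : ℝ} (hC : ∀ x, ‖g x‖ ≤ C) :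
    Tendsto (fun n => ∫ x, g x ∂(M n : Measure ℝ)) atTop (𝓝 (∫ x, g x ∂(L : Measure ℝ))) :=
  (FiniteMeasure.tendsto_iff_forall_integral_rclike_tendsto ℂ).1 h
    (BoundedContinuousFunction.ofNormedAddCommGroup g hg C hC)

theorem tendsto_succ_mul_exp_div_sub_one (w : ℂ) :
    Tendsto (fun n : ℕ => ((n : ℂ) + 1) * (Complex.exp (w / ((n : ℂ) + 1)) - 1)) atTop (𝓝 w) := by
  have := (tendsto_nat_mul_exp_div_sub_one w).comp (tendsto_add_atTop_nat 1)
  refine this.congr fun n => ?_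
  simp

/-- `n` times the `n`-th convolution root. -/
noncomputable def rootMeasure (r : ℕ → Measure ℝ) (n : ℕ) : Measure ℝ :=
  ENNReal.ofReal ((n : ℝ) + 1) • r (n + 1)

theorem charFun_rootMeasure_sub {r : ℕ → Measure ℝ} (hr : ∀ n, IsProbabilityMeasure (r n)) (n : ℕ)
    (z : ℝ) : charFun (rootMeasure r n) z - charFun (rootMeasure r n) 0
      = ((n : ℂ) + 1) * (charFun (r (n + 1)) z - 1) := by
  have := hr (n + 1)
  rw [rootMeasure, charFun_smul_measure (by positivity), charFun_smul_measure (by positivity),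
    charFun_zero]
  simp
  ring

theorem isFiniteMeasure_rootMeasure {r : ℕ → Measure ℝ} (hr : ∀ n, IsProbabilityMeasure (r n))
    (n : ℕ) : IsFiniteMeasure (rootMeasure r n) :=
  have := hr (n + 1)
  Measure.smul_finite _ ENNReal.ofReal_ne_top

/-- `m (e^{φ/m} - 1) → φ`, and since `Re φ ≤ 0` these quantities are bounded by `|φ|`, which serves
as dominating function later. The shift `m = n + 1` avoids the root of index 0, about which nothing
is known beyond its being a probability measure. -/
theorem IsRootSeq.exists_exponent_limit {μ : Measure ℝ} {r : ℕ → Measure ℝ} (h : IsRootSeq μ r) :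
    ∃ φ : ℝ → ℂ, Continuous φ ∧ φ 0 = 0 ∧ (∀ z, charFun μ z = Complex.exp (φ z)) ∧
      (∀ n z, charFun (r (n + 1)) z = Complex.exp (φ z / ((n : ℂ) + 1))) ∧
      (∀ z, Tendsto (fun n => charFun (rootMeasure r n) z - charFun (rootMeasure r n) 0) atTop
        (𝓝 (φ z))) ∧
      ∀ n z, ‖charFun (rootMeasure r n) z - charFun (rootMeasure r n) 0‖ ≤ ‖φ z‖ := by
  have := h.prob
  obtain ⟨φ, hφ, h0, he, hn⟩ := h.exists_exponent
  have hn' : ∀ (n : ℕ) z, charFun (r (n + 1)) z = Complex.exp (φ z / ((n : ℂ) + 1)) := by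
    intro n z
    rw [hn (n + 1) (by lia)]
    push_cast
    rfl
  refine ⟨φ, hφ, h0, he, hn', fun z => ?_, fun n z => ?_⟩
  · simp_rw [charFun_rootMeasure_sub h.prob_root, hn']
    exact tendsto_succ_mul_exp_div_sub_one (φ z)
  · have hre : (φ z).re ≤ 0 := by
      have h1 := norm_charFun_le_one (μ := μ) z
      rwa [he, Complex.norm_exp, Real.exp_le_one_iff] at h1
    have hcast : ((n : ℂ) + 1) = ((n + 1 : ℝ) : ℂ) := by push_cast; rfl
    have hpos : (0 : ℝ) < n + 1 := by positivity
    rw [charFun_rootMeasure_sub h.prob_root, hn', norm_mul]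
    have h2 : ‖Complex.exp (φ z / ((n : ℂ) + 1)) - 1‖ ≤ ‖φ z / ((n : ℂ) + 1)‖ := by
      refine norm_exp_sub_one_le_of_re_nonpos ?_
      rw [hcast, Complex.div_ofReal_re]
      exact div_nonpos_of_nonpos_of_nonneg hre hpos.le
    rw [norm_div, hcast, Complex.norm_real, Real.norm_of_nonneg hpos.le] at *
    calc _ ≤ (n + 1 : ℝ) * (‖φ z‖ / (n + 1)) := mul_le_mul_of_nonneg_left h2 hpos.le
      _ = _ := by field_simp

/-- The **Lévy-Khintchine representation** in canonical form. -/
theorem exists_canonicalExponent_of_mem_ID {μ : Measure ℝ} (h : μ ∈ ID) :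
    ∃ (c : ℝ) (M : Measure ℝ), IsFiniteMeasure M ∧
      ∀ z, charFun μ z = Complex.exp (canonicalExponent c M z) := by
  obtain ⟨r, hr⟩ := exists_isRootSeq h
  obtain ⟨φ, hφ, hφ0, he, -, hlim, hbd⟩ := hr.exists_exponent_limit
  have hfin := isFiniteMeasure_rootMeasure hr.prob_root
  have hwfin : ∀ n, IsFiniteMeasure (weighted levyWeight (rootMeasure r n)) := fun n =>
    isFiniteMeasure_weighted (lt_of_le_of_lt (lintegral_mono fun x =>
      ENNReal.ofReal_le_ofReal (levyWeight_le_two x)) (by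
        rw [lintegral_const]
        exact ENNReal.mul_lt_top ENNReal.ofReal_lt_top (measure_lt_top _ _)))
  let M : ℕ → FiniteMeasure ℝ := fun n => ⟨weighted levyWeight (rootMeasure r n), hwfin n⟩
  let c : ℕ → ℝ := fun n => ∫ x, Real.sin x ∂(rootMeasure r n)
  have hcan : ∀ n z, canonicalExponent (c n) (M n : Measure ℝ) z
      = charFun (rootMeasure r n) z - charFun (rootMeasure r n) 0 := fun n z =>
    canonicalExponent_weighted _ z
  have hψ : Continuous fun z => φ z - (1 / 2 : ℂ) * ∫ u in (-1 : ℝ)..1, φ (z + u) := by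
    refine hφ.sub (continuous_const.mul ?_)
    exact intervalIntegral.continuous_parametric_intervalIntegral_of_continuous'
      (f := fun z u => φ (z + u)) (by unfold Function.uncurry; fun_prop) _ _
  -- The averaging identity turns convergence of exponents into convergence of the characteristic
  -- functions of the weighted root measures.
  obtain ⟨L, hL, -⟩ := exists_tendsto_of_tendsto_charFun (M := M) hψ.continuousAt (fun z => by
    have h1 : ∀ n, charFun (M n : Measure ℝ) z
        = (charFun (rootMeasure r n) z - charFun (rootMeasure r n) 0) - (1 / 2 : ℂ) *
          ∫ u in (-1 : ℝ)..1, (charFun (rootMeasure r n) (z + u) - charFun (rootMeasure r n) 0) := by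
      intro n
      simp_rw [← canonicalExponent_sub_average (c n) (M n : Measure ℝ), hcan]
    simp_rw [h1]
    refine (hlim z).sub (tendsto_const_nhds.mul ?_)
    refine intervalIntegral.tendsto_integral_filter_of_dominated_convergence
      (fun u => ‖φ (z + u)‖) ?_ ?_ ?_ ?_
    · refine .of_forall fun n => Continuous.aestronglyMeasurable ?_
      have := continuous_charFun (μ := rootMeasure r n)
      fun_prop
    · exact .of_forall fun n => .of_forall fun u _ => hbd n _
    · exact Continuous.intervalIntegrable (by fun_prop) _ _
    · exact .of_forall fun u _ => hlim _)
  have hD : ∀ z : ℝ, Tendsto (fun n => Complex.I * c n * z) atTop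
      (𝓝 (φ z - ∫ x, levyKernel z x ∂(L : Measure ℝ))) := by
    intro z
    refine ((hlim z).sub (tendsto_integral_of_tendsto_finiteMeasure hL (continuous_levyKernel z)
      (norm_levyKernel_le z))).congr fun n => ?_
    rw [← hcan, canonicalExponent]
    ring
  -- The kernel integrals converge, so the drift terms do too; the imaginary part at `z = 1`
  -- isolates the drift.
  have hc : Tendsto c atTop (𝓝 (φ 1 - ∫ x, levyKernel 1 x ∂(L : Measure ℝ)).im) := by
    refine ((Complex.continuous_im.tendsto _).comp (hD 1)).congr fun n => ?_
    simp
  refine ⟨(φ 1 - ∫ x, levyKernel 1 x ∂(L : Measure ℝ)).im, L, inferInstance, fun z => ?_⟩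
  rw [he]
  congr 1
  have h1 : Tendsto (fun n => Complex.I * c n * z) atTop
      (𝓝 (Complex.I * ((φ 1 - ∫ x, levyKernel 1 x ∂(L : Measure ℝ)).im : ℂ) * z)) :=
    (tendsto_const_nhds.mul ((Complex.continuous_ofReal.tendsto _).comp hc)).mul_const _
  rw [canonicalExponent, ← tendsto_nhds_unique (hD z) h1]
  ring

theorem exists_hasTriplet_of_mem_ID {μ : Measure ℝ} (h : μ ∈ ID) :
    ∃ γ b ν, HasTriplet μ γ b ν := by
  obtain ⟨c, M, hM, hμ⟩ := exists_canonicalExponent_of_mem_ID h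
  obtain ⟨γ, b, ν, hb, hν, he⟩ := exists_levyExponent_eq c M
  exact ⟨γ, b, ν, h.1, hb, hν, fun z => by rw [hμ, he]⟩

/-! ### Exponential tilting of laws on the half-line -/

theorem charFun_weighted_exp (μ : Measure ℝ) (z : ℝ) :
    charFun (weighted (fun x => Real.exp (-x)) μ) z
      = ∫ x : ℝ, Complex.exp (z * x * Complex.I) * Real.exp (-x) ∂μ := by
  rw [charFun_apply_real, integral_weighted (by fun_prop) (.of_forall fun x => (Real.exp_pos _).le)]

/-- `e^{-x}` is multiplicative over sums, so tilting commutes with convolution. -/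
theorem charFun_weighted_exp_conv (μ ν : Measure ℝ) [SFinite μ] [SFinite ν] (z : ℝ) :
    charFun (weighted (fun x => Real.exp (-x)) (Measure.conv μ ν)) z
      = charFun (weighted (fun x => Real.exp (-x)) μ) z
        * charFun (weighted (fun x => Real.exp (-x)) ν) z := by
  simp only [charFun_weighted_exp]
  rw [Measure.conv, integral_map (by fun_prop) (by fun_prop), ← integral_prod_mul]
  refine integral_congr_ae (.of_forall fun p => ?_)
  simp only
  rw [neg_add, Real.exp_add, Complex.ofReal_add, mul_add, add_mul, Complex.exp_add]
  push_cast
  ring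

theorem charFun_weighted_exp_convIter {ν : Measure ℝ} (hν : IsProbabilityMeasure ν) (n : ℕ) (z : ℝ) :
    charFun (weighted (fun x => Real.exp (-x)) (convIter ν n)) z
      = charFun (weighted (fun x => Real.exp (-x)) ν) z ^ n := by
  induction n with
  | zero => simp [convIter, charFun_weighted_exp]
  | succ n ih =>
    have := (convIter_spec hν n).1
    rw [convIter, charFun_weighted_exp_conv, ih, pow_succ]

theorem ae_nonneg_of_measure_Iio {μ : Measure ℝ} (h : μ (Set.Iio 0) = 0) : ∀ᵐ x ∂μ, 0 ≤ x := by
  simpa [ae_iff, Set.Iio] using h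

theorem isFiniteMeasure_weighted_exp {μ : Measure ℝ} [IsFiniteMeasure μ] (h : μ (Set.Iio 0) = 0) :
    IsFiniteMeasure (weighted (fun x => Real.exp (-x)) μ) := by
  refine isFiniteMeasure_weighted (lt_of_le_of_lt (lintegral_mono_ae (g := fun _ => 1) ?_) ?_)
  · filter_upwards [ae_nonneg_of_measure_Iio h] with x hx
    simpa using hx
  · simp

/-- The Laplace transform at `1`. -/
noncomputable def laplaceOne (μ : Measure ℝ) : ℝ :=
  (weighted (fun x => Real.exp (-x)) μ).real Set.univ

theorem charFun_weighted_exp_zero (μ : Measure ℝ) :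
    charFun (weighted (fun x => Real.exp (-x)) μ) 0 = laplaceOne μ := by
  rw [charFun_zero, laplaceOne]

theorem laplaceOne_pos {μ : Measure ℝ} [IsProbabilityMeasure μ] (h : μ (Set.Iio 0) = 0) :
    0 < laplaceOne μ := by
  have := isFiniteMeasure_weighted_exp h
  have hne : weighted (fun x => Real.exp (-x)) μ ≠ 0 := by
    rw [weighted, Ne, withDensity_eq_zero_iff (by fun_prop)]
    intro h0
    obtain ⟨x, hx⟩ := h0.exists
    simp only [Pi.zero_apply, ENNReal.ofReal_eq_zero] at hx
    exact absurd (Real.exp_pos (-x)) (not_lt.2 hx)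
  refine lt_of_le_of_ne measureReal_nonneg fun h0 => hne ?_
  rw [laplaceOne, eq_comm, measureReal_eq_zero_iff] at h0
  exact Measure.measure_univ_eq_zero.1 h0

/-- The exponentially tilted law `e^{-x} μ(dx) / ∫ e^{-y} μ(dy)`. -/
noncomputable def expTilt (μ : Measure ℝ) : Measure ℝ :=
  ENNReal.ofReal (laplaceOne μ)⁻¹ • weighted (fun x => Real.exp (-x)) μ

theorem isProbabilityMeasure_expTilt {μ : Measure ℝ} [IsProbabilityMeasure μ]
    (h : μ (Set.Iio 0) = 0) : IsProbabilityMeasure (expTilt μ) := by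
  have := isFiniteMeasure_weighted_exp h
  have hp := laplaceOne_pos h
  refine ⟨?_⟩
  rw [expTilt, Measure.smul_apply, smul_eq_mul, ← ofReal_measureReal, ← laplaceOne,
    ← ENNReal.ofReal_mul (inv_nonneg.2 hp.le), inv_mul_cancel₀ hp.ne', ENNReal.ofReal_one]

theorem charFun_weighted_exp_eq {μ : Measure ℝ} [IsProbabilityMeasure μ] (h : μ (Set.Iio 0) = 0)
    (z : ℝ) : charFun (weighted (fun x => Real.exp (-x)) μ) z = laplaceOne μ * charFun (expTilt μ) z := by
  have hp := laplaceOne_pos h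
  rw [expTilt, charFun_smul_measure (inv_nonneg.2 hp.le), ← mul_assoc, ← Complex.ofReal_mul,
    mul_inv_cancel₀ hp.ne']
  simp

theorem IsRootSeq.convIter_eq {μ : Measure ℝ} {r : ℕ → Measure ℝ} (h : IsRootSeq μ r) {n : ℕ}
    (hn : 1 ≤ n) : convIter (r n) n = μ := by
  have := h.prob
  have h1 := convIter_spec (h.prob_root n) n
  have := h1.1
  exact Measure.ext_of_charFun (funext fun t => by rw [h1.2, h.pow_eq n hn])

/-- A sum is negative when all its summands are. Hence the roots of a law on `[0, ∞)` live there
too. -/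
theorem pow_measure_Iio_le_convIter {ν : Measure ℝ} (hν : IsProbabilityMeasure ν) (n : ℕ) :
    ν (Set.Iio 0) ^ (n + 1) ≤ convIter ν (n + 1) (Set.Iio 0) := by
  induction n with
  | zero => simp [convIter]
  | succ n ih =>
    have := (convIter_spec hν (n + 1)).1
    rw [convIter, Measure.conv, Measure.map_apply (by fun_prop) measurableSet_Iio, pow_succ]
    calc _ ≤ convIter ν (n + 1) (Set.Iio 0) * ν (Set.Iio 0) := mul_le_mul_left ih _
      _ = ((convIter ν (n + 1)).prod ν) (Set.Iio 0 ×ˢ Set.Iio 0) := (Measure.prod_prod _ _).symm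
      _ ≤ _ := measure_mono fun p hp => by
        simp only [Set.mem_prod, Set.mem_Iio] at hp
        simpa using add_neg hp.1 hp.2

theorem exists_isRootSeq_of_mem_IDplus {μ : Measure ℝ} (h : μ ∈ IDplus) :
    ∃ r, IsRootSeq μ r ∧ ∀ n, r n (Set.Iio 0) = 0 := by
  obtain ⟨r, hr⟩ := exists_isRootSeq h.1
  -- The root of index 0 is unconstrained and may charge the negatives, so it is replaced by `μ`.
  refine ⟨fun n => if n = 0 then μ else r n, ⟨hr.prob, fun n => ?_, fun n hn => ?_⟩, fun n => ?_⟩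
  · split_ifs
    exacts [hr.prob, hr.prob_root n]
  · rw [if_neg (by lia)]
    exact hr.pow_eq n hn
  · beta_reduce
    split_ifs with h0
    · exact h.2
    · obtain ⟨k, rfl⟩ := Nat.exists_eq_succ_of_ne_zero h0
      have h1 := pow_measure_Iio_le_convIter (hr.prob_root (k + 1)) k
      rw [hr.convIter_eq (by lia), h.2] at h1
      simpa using h1

/-- Tilting is multiplicative under convolution, and so are the normalising constants. -/
theorem IsRootSeq.expTilt {μ : Measure ℝ} {r : ℕ → Measure ℝ} (h : IsRootSeq μ r)
    (hμ : μ (Set.Iio 0) = 0) (hr : ∀ n, r n (Set.Iio 0) = 0) :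
    (∀ n, 1 ≤ n → laplaceOne (r n) ^ n = laplaceOne μ) ∧
      IsRootSeq (expTilt μ) fun n => expTilt (r n) := by
  have := h.prob
  have := h.prob_root
  have hG : ∀ n, 1 ≤ n → ∀ z, charFun (weighted (fun x => Real.exp (-x)) (r n)) z ^ n
      = charFun (weighted (fun x => Real.exp (-x)) μ) z := fun n hn z => by
    rw [← charFun_weighted_exp_convIter (h.prob_root n), h.convIter_eq hn]
  have hL : ∀ n, 1 ≤ n → laplaceOne (r n) ^ n = laplaceOne μ := by
    intro n hn
    have := hG n hn 0
    rw [charFun_weighted_exp_zero, charFun_weighted_exp_zero] at this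
    exact_mod_cast this
  refine ⟨hL, isProbabilityMeasure_expTilt hμ, fun n => isProbabilityMeasure_expTilt (hr n),
    fun n hn z => ?_⟩
  rw [LevySub.expTilt, LevySub.expTilt, charFun_smul_measure (inv_nonneg.2 (laplaceOne_pos hμ).le),
    charFun_smul_measure (inv_nonneg.2 (laplaceOne_pos (hr n)).le), mul_pow, hG n hn, ← hL n hn]
  push_cast
  rw [inv_pow]

/-! ### The representation of exponents on the half-line -/

/-- The weight `1 - e^{-x}`, comparable to `1 ∧ x` on the half-line. -/
noncomputable def subWeight (x : ℝ) : ℝ := 1 - Real.exp (-x)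

theorem continuous_subWeight : Continuous subWeight := by
  unfold subWeight
  fun_prop

theorem measurable_subWeight : Measurable subWeight := continuous_subWeight.measurable

theorem subWeight_nonneg {x : ℝ} (hx : 0 ≤ x) : 0 ≤ subWeight x := by
  simpa [subWeight] using hx

theorem subWeight_pos {x : ℝ} (hx : 0 < x) : 0 < subWeight x := by
  simpa [subWeight] using hx

theorem min_le_subWeight {x : ℝ} (hx : 0 ≤ x) : min 1 x ≤ 2 * subWeight x := by
  have h1 : Real.exp (-x) * (1 + x) ≤ 1 := by
    have := Real.add_one_le_exp x
    have h2 : Real.exp (-x) * Real.exp x = 1 := by rw [← Real.exp_add]; simp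
    nlinarith [Real.exp_pos (-x)]
  have h3 := Real.exp_pos (-x)
  unfold subWeight
  rcases le_total x 1 with h | h
  · rw [min_eq_right h]
    nlinarith
  · rw [min_eq_left h]
    nlinarith

/-- The continuous extension of `(e^{izx} - 1) / (1 - e^{-x})` to `[0, ∞)`, extended to be constant
on `(-∞, 0]`. -/
noncomputable def subKernel (z x : ℝ) : ℂ :=
  (dslope subWeight 0 (max x 0))⁻¹ •
    dslope (fun x : ℝ => Complex.exp (Complex.I * z * x)) 0 (max x 0)

theorem hasDerivAt_subWeight_zero : HasDerivAt subWeight 1 0 := by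
  have := ((hasDerivAt_id (0 : ℝ)).neg.exp).const_sub 1
  have h : HasDerivAt (fun x : ℝ => 1 - Real.exp (-x)) 1 0 := by simpa using this
  exact h

theorem hasDerivAt_exp_I_mul (z : ℝ) :
    HasDerivAt (fun x : ℝ => Complex.exp (Complex.I * z * x)) (Complex.I * z) 0 := by
  have := (((hasDerivAt_id (0 : ℂ)).const_mul (Complex.I * z)).cexp).comp_ofReal (z := 0)
  simpa using this

theorem subKernel_of_nonpos {x : ℝ} (hx : x ≤ 0) (z : ℝ) : subKernel z x = Complex.I * z := by
  rw [subKernel, max_eq_right hx, dslope_same, dslope_same, hasDerivAt_subWeight_zero.deriv,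
    (hasDerivAt_exp_I_mul z).deriv]
  simp

theorem subKernel_of_pos {x : ℝ} (hx : 0 < x) (z : ℝ) :
    subKernel z x = (Complex.exp (Complex.I * z * x) - 1) / subWeight x := by
  have h1 : (x : ℂ) ≠ 0 := by exact_mod_cast hx.ne'
  have h2 : (subWeight x : ℂ) ≠ 0 := by exact_mod_cast (subWeight_pos hx).ne'
  rw [subKernel, max_eq_left hx.le, dslope_of_ne _ hx.ne', dslope_of_ne _ hx.ne', slope, slope]
  simp only [sub_zero, vsub_eq_sub, smul_eq_mul, Complex.real_smul]
  have h3 : subWeight 0 = 0 := by simp [subWeight]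
  rw [h3]
  push_cast
  simp
  field_simp

theorem dslope_subWeight_ne_zero {x : ℝ} (hx : 0 ≤ x) : dslope subWeight 0 x ≠ 0 := by
  rcases hx.eq_or_lt with rfl | h
  · rw [dslope_same, hasDerivAt_subWeight_zero.deriv]
    exact one_ne_zero
  · rw [dslope_of_ne _ h.ne', slope]
    have h3 : subWeight 0 = 0 := by simp [subWeight]
    simp [h3, h.ne', (subWeight_pos h).ne']

theorem continuous_dslope_zero {E : Type*} [NormedAddCommGroup E] [NormedSpace ℝ E] {f : ℝ → E}
    {d : E} (hf : Continuous f) (hd : HasDerivAt f d 0) : Continuous (dslope f 0) := by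
  rw [← continuousOn_univ, continuousOn_dslope univ_mem]
  exact ⟨hf.continuousOn, hd.differentiableAt⟩

theorem continuous_subKernel (z : ℝ) : Continuous (subKernel z) := by
  have h1 := (continuous_dslope_zero continuous_subWeight hasDerivAt_subWeight_zero).comp
    (by fun_prop : Continuous fun x : ℝ => max x 0)
  have h2 := (continuous_dslope_zero (by fun_prop) (hasDerivAt_exp_I_mul z)).comp
    (by fun_prop : Continuous fun x : ℝ => max x 0)
  exact (h1.inv₀ fun x => dslope_subWeight_ne_zero (le_max_right x 0)).smul h2

theorem norm_exp_I_mul_sub_one_le (z x : ℝ) :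
    ‖Complex.exp (Complex.I * z * x) - 1‖ ≤ (2 + |z|) * min 1 |x| := by
  have h1 : ‖Complex.exp (Complex.I * z * x) - 1‖ ≤ 2 :=
    (norm_sub_le _ _).trans (by rw [norm_exp_I_mul_mul, norm_one]; norm_num)
  have h2 : ‖Complex.exp (Complex.I * z * x) - 1‖ ≤ |z| * |x| := by
    refine (norm_exp_sub_one_le_of_re_nonpos (by simp)).trans ?_
    simp
  rcases le_total |x| 1 with h | h
  · rw [min_eq_right h]
    nlinarith [abs_nonneg x]
  · rw [min_eq_left h]
    linarith [abs_nonneg z]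

theorem norm_subKernel_le (z x : ℝ) : ‖subKernel z x‖ ≤ 2 * (2 + |z|) := by
  rcases le_or_gt x 0 with h | h
  · rw [subKernel_of_nonpos h]
    simp
    linarith [abs_nonneg z]
  · have hw := subWeight_pos h
    rw [subKernel_of_pos h, norm_div, Complex.norm_real, Real.norm_of_nonneg hw.le, div_le_iff₀ hw]
    have h1 := norm_exp_I_mul_sub_one_le z x
    have h2 := min_le_subWeight h.le
    rw [abs_of_pos h] at h1
    nlinarith [abs_nonneg z]

theorem subKernel_mul_subWeight {x : ℝ} (hx : 0 ≤ x) (z : ℝ) :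
    subKernel z x * subWeight x = Complex.exp (Complex.I * z * x) - 1 := by
  rcases hx.eq_or_lt with rfl | h
  · simp [subWeight]
  · rw [subKernel_of_pos h, div_mul_cancel₀]
    exact_mod_cast (subWeight_pos h).ne'

theorem integral_exp_I_mul_sub_one (μ : Measure ℝ) [IsFiniteMeasure μ] (z : ℝ) :
    ∫ x : ℝ, (Complex.exp (Complex.I * z * x) - 1) ∂μ = charFun μ z - charFun μ 0 := by
  have h1 : Integrable (fun x : ℝ => Complex.exp (Complex.I * z * x)) μ :=
    Integrable.of_bound (by fun_prop) 1 (.of_forall fun x => (norm_exp_I_mul_mul z x).le)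
  rw [integral_sub h1 (integrable_const _), charFun_zero, charFun_apply_real]
  have h4 : ∫ x : ℝ, Complex.exp (Complex.I * z * x) ∂μ
      = ∫ x : ℝ, Complex.exp (z * x * Complex.I) ∂μ := by
    congr 1
    ext x
    congr 1
    ring
  rw [h4]
  simp

/-- Test against the bounded continuous function `1 ∧ x⁻`, which is positive exactly on the
negatives. -/
theorem measure_Iio_eq_zero_of_tendsto {M : ℕ → FiniteMeasure ℝ} {L : FiniteMeasure ℝ}
    (h : Tendsto M atTop (𝓝 L)) (h0 : ∀ n, (M n : Measure ℝ) (Set.Iio 0) = 0) :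
    (L : Measure ℝ) (Set.Iio 0) = 0 := by
  let f : ℝ → ℝ := fun x => min 1 (max 0 (-x))
  have hf : Continuous f := by fun_prop
  have hf0 : ∀ x, 0 ≤ f x := fun x => le_min zero_le_one (le_max_left _ _)
  have hf1 : ∀ x, ‖f x‖ ≤ 1 := fun x => by
    rw [Real.norm_of_nonneg (hf0 x)]
    exact min_le_left _ _
  have h1 := FiniteMeasure.tendsto_iff_forall_integral_tendsto.1 h
    (BoundedContinuousFunction.ofNormedAddCommGroup f hf 1 hf1)
  have h2 : ∀ n, ∫ x, f x ∂(M n : Measure ℝ) = 0 := fun n => by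
    refine integral_eq_zero_of_ae ?_
    filter_upwards [ae_nonneg_of_measure_Iio (h0 n)] with x hx
    simp [f, hx]
  have h3 : ∫ x, f x ∂(L : Measure ℝ) = 0 := by
    refine tendsto_nhds_unique h1 ?_
    have : (fun n => ∫ x, f x ∂(M n : Measure ℝ)) = fun _ => 0 := funext h2
    change Tendsto (fun n => ∫ x, f x ∂(M n : Measure ℝ)) atTop (𝓝 0)
    rw [this]
    exact tendsto_const_nhds
  rw [integral_eq_zero_iff_of_nonneg hf0 (Integrable.of_bound hf.aestronglyMeasurable 1
    (.of_forall hf1))] at h3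
  rw [measure_eq_zero_iff_ae_notMem]
  filter_upwards [h3] with x hx hx'
  have : 0 < f x := lt_min one_pos (lt_max_of_lt_right (by simpa using hx'))
  exact this.ne' hx

theorem laplaceOne_eq_exp {μ : Measure ℝ} [IsProbabilityMeasure μ] (h : μ (Set.Iio 0) = 0) :
    laplaceOne μ = Real.exp (Real.log (laplaceOne μ)) := (Real.exp_log (laplaceOne_pos h)).symm

/-- The exponent of a law in `ID(ℝ⁺)` in terms of a finite measure on the half-line. -/
theorem exists_subordinator_measure {μ : Measure ℝ} (h : μ ∈ IDplus) :
    ∃ N : Measure ℝ, IsFiniteMeasure N ∧ N (Set.Iio 0) = 0 ∧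
      ∀ z, charFun μ z = Complex.exp (∫ x, subKernel z x ∂N) := by
  obtain ⟨r, hr, hr0⟩ := exists_isRootSeq_of_mem_IDplus h
  obtain ⟨hL, ht⟩ := hr.expTilt h.2 hr0
  have := hr.prob
  have hrp := hr.prob_root
  obtain ⟨φ, hφ, hφ0, he, -, hlim, -⟩ := hr.exists_exponent_limit
  obtain ⟨φ', hφ', hφ0', he', hn', -, -⟩ := ht.exists_exponent_limit
  have hfin := isFiniteMeasure_rootMeasure hr.prob_root
  have hroot0 : ∀ n, rootMeasure r n (Set.Iio 0) = 0 := fun n => by simp [rootMeasure, hr0]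
  have hwfin : ∀ n, IsFiniteMeasure (weighted subWeight (rootMeasure r n)) := fun n => by
    refine isFiniteMeasure_weighted (lt_of_le_of_lt (lintegral_mono (g := fun _ => 1) fun x => ?_)
      (by simp))
    simp only [subWeight, ENNReal.ofReal_le_one]
    linarith [Real.exp_pos (-x)]
  let M : ℕ → FiniteMeasure ℝ := fun n => ⟨weighted subWeight (rootMeasure r n), hwfin n⟩
  have hae : ∀ n, ∀ᵐ x ∂(rootMeasure r n), 0 ≤ x := fun n => ae_nonneg_of_measure_Iio (hroot0 n)
  set ℓ : ℝ := Real.log (laplaceOne μ) with hℓ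
  have hlog : ∀ n : ℕ, Real.log (laplaceOne (r (n + 1))) = ℓ / (n + 1) := by
    intro n
    rw [hℓ, ← hL (n + 1) (by lia), Real.log_pow]
    push_cast
    field_simp
  have hG : ∀ n z, charFun (weighted (fun x => Real.exp (-x)) (r (n + 1))) z
      = Complex.exp ((ℓ + φ' z) / ((n : ℂ) + 1)) := by
    intro n z
    rw [charFun_weighted_exp_eq (hr0 _), hn', laplaceOne_eq_exp (hr0 _), hlog, Complex.ofReal_exp,
      ← Complex.exp_add]
    congr 1
    push_cast
    ring
  -- Split `1 - e^{-x}`: the first term gives `m (e^{φ/m} - 1)` and the tilted one `m (e^{(ℓ+φ')/m}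
  -- - 1)`, with `m = n + 1`. The limit `φ - (ℓ + φ')` is continuous, so Lévy's theorem applies.
  have hcf : ∀ n z, charFun (M n : Measure ℝ) z
      = (charFun (rootMeasure r n) z - charFun (rootMeasure r n) 0)
        - ((n : ℂ) + 1) * (Complex.exp ((ℓ + φ' z) / ((n : ℂ) + 1)) - 1) := by
    intro n z
    have h1 : charFun (M n : Measure ℝ) z = charFun (rootMeasure r n) z
        - ∫ x : ℝ, Complex.exp (z * x * Complex.I) * Real.exp (-x) ∂(rootMeasure r n) := by
      rw [charFun_apply_real, charFun_apply_real]
      change ∫ x : ℝ, Complex.exp (z * x * Complex.I) ∂(weighted subWeight (rootMeasure r n)) = _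
      have hb : ∀ x : ℝ, ‖Complex.exp (z * x * Complex.I)‖ = 1 := fun x => by
        rw [← Complex.ofReal_mul, Complex.norm_exp_ofReal_mul_I]
      rw [integral_weighted measurable_subWeight ((hae n).mono fun x => subWeight_nonneg),
        ← integral_sub]
      · refine integral_congr_ae (.of_forall fun x => ?_)
        simp only [subWeight]
        push_cast
        ring
      · exact Integrable.of_bound (by fun_prop) 1 (.of_forall fun x => (hb x).le)
      · refine Integrable.of_bound (by fun_prop) 1 ?_
        filter_upwards [hae n] with x hx
        rw [norm_mul, hb, one_mul, Complex.norm_real, Real.norm_of_nonneg (Real.exp_pos _).le]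
        simpa using hx
    have h2 : ∫ x : ℝ, Complex.exp (z * x * Complex.I) * Real.exp (-x) ∂(rootMeasure r n)
        = ((n : ℂ) + 1) * Complex.exp ((ℓ + φ' z) / ((n : ℂ) + 1)) := by
      rw [← hG, charFun_weighted_exp, rootMeasure, integral_smul_measure,
        ENNReal.toReal_ofReal (by positivity), Complex.real_smul]
      push_cast
      rfl
    have h3 : charFun (rootMeasure r n) 0 = (n : ℂ) + 1 := by
      rw [rootMeasure, charFun_smul_measure (by positivity), charFun_zero]
      simp
    rw [h1, h2, h3]
    ring
  obtain ⟨N, hN, -⟩ := exists_tendsto_of_tendsto_charFun (M := M)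
    (g := fun z => φ z - (ℓ + φ' z)) (by fun_prop) (fun z => by
      simp_rw [hcf]
      exact (hlim z).sub (tendsto_succ_mul_exp_div_sub_one _))
  refine ⟨N, inferInstance, measure_Iio_eq_zero_of_tendsto hN fun n => ?_, fun z => ?_⟩
  · exact withDensity_absolutelyContinuous _ _ (hroot0 n)
  · rw [he]
    congr 1
    refine tendsto_nhds_unique (hlim z) ((tendsto_integral_of_tendsto_finiteMeasure hN
      (continuous_subKernel z) (norm_subKernel_le z)).congr fun n => ?_)
    change ∫ x, subKernel z x ∂(weighted subWeight (rootMeasure r n)) = _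
    rw [integral_weighted measurable_subWeight ((hae n).mono fun x => subWeight_nonneg),
      ← integral_exp_I_mul_sub_one]
    refine integral_congr_ae ?_
    filter_upwards [hae n] with x hx
    exact subKernel_mul_subWeight hx z

/-! ### Drift and jump measure on the half-line -/

theorem integrable_of_finite_var {E : Type*} [NormedAddCommGroup E] {ρ : Measure ℝ}
    (hρ : ∫⁻ x, ENNReal.ofReal (min 1 |x|) ∂ρ < ⊤) {f : ℝ → E} (hf : AEStronglyMeasurable f ρ)
    {C : ℝ} (h : ∀ᵐ x ∂ρ, ‖f x‖ ≤ C * min 1 |x|) : Integrable f ρ := by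
  have h1 : Integrable (fun x : ℝ => min 1 |x|) ρ := by
    refine ⟨by fun_prop, ?_⟩
    rw [hasFiniteIntegral_iff_ofReal (.of_forall fun x => by positivity)]
    exact hρ
  exact (h1.const_mul C).mono' hf h

theorem integral_trunc (ρ : Measure ℝ) : ∫ x, trunc x ∂ρ = ∫ x in {x : ℝ | |x| ≤ 1}, x ∂ρ := by
  rw [← integral_indicator (measurableSet_le (by fun_prop) (by fun_prop))]
  rfl

theorem abs_trunc_le (x : ℝ) : |trunc x| ≤ min 1 |x| := by
  unfold trunc
  split_ifs with h
  · exact le_min h le_rfl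
  · simp

/-- `τ` is `ρ`-integrable here, so the compensator cancels the extra drift. -/
theorem levyExponent_pair {ρ : Measure ℝ} (hρ : ∫⁻ x, ENNReal.ofReal (min 1 |x|) ∂ρ < ⊤)
    (β₀ z : ℝ) : levyExponent (β₀ + ∫ x in {x : ℝ | |x| ≤ 1}, x ∂ρ) 0 ρ z
      = Complex.I * z * β₀ + ∫ x : ℝ, (Complex.exp (Complex.I * z * x) - 1) ∂ρ := by
  have h1 : Integrable (fun x : ℝ => Complex.exp (Complex.I * z * x) - 1) ρ :=
    integrable_of_finite_var hρ (by fun_prop) (.of_forall (norm_exp_I_mul_sub_one_le z))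
  have h2 : Integrable trunc ρ :=
    integrable_of_finite_var (C := 1) hρ measurable_trunc.aestronglyMeasurable
      (.of_forall fun x => by simpa using abs_trunc_le x)
  have h3 : Integrable (fun x => Complex.I * (trunc x : ℂ) * z) ρ :=
    (h2.ofReal.const_mul Complex.I).mul_const _
  unfold levyExponent
  rw [integral_sub h1 h3, integral_mul_const, integral_const_mul, integral_complex_ofReal,
    integral_trunc]
  push_cast
  ring

theorem isLevyMeasure_of_finite_var {ρ : Measure ℝ} (h0 : ρ {0} = 0)
    (hρ : ∫⁻ x, ENNReal.ofReal (min 1 |x|) ∂ρ < ⊤) : IsLevyMeasure ρ := by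
  refine ⟨h0, (lintegral_mono fun x => ENNReal.ofReal_le_ofReal ?_).trans_lt hρ⟩
  rcases le_total |x| 1 with h | h
  · rw [min_eq_right h]
    refine (min_le_right _ _).trans ?_
    nlinarith [abs_nonneg x]
  · rw [min_eq_left h]
    exact min_le_left _ _

/-- Laws in `ID(ℝ⁺)` have a nonnegative drift and a Lévy measure on `(0, ∞)`. -/
theorem exists_hasPair_of_mem_IDplus {μ : Measure ℝ} (h : μ ∈ IDplus) :
    ∃ (β₀ : ℝ) (ρ : Measure ℝ), 0 ≤ β₀ ∧ HasPair μ β₀ ρ ∧ ρ (Set.Iic 0) = 0 := by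
  obtain ⟨N, hN, hN0, he⟩ := exists_subordinator_measure h
  have hNae : ∀ᵐ x ∂N, 0 ≤ x := ae_nonneg_of_measure_Iio hN0
  have hpos : ∀ᵐ x ∂N, x ≠ 0 → 0 < subWeight x := by
    filter_upwards [hNae] with x hx h0
    exact subWeight_pos (lt_of_le_of_ne hx (Ne.symm h0))
  have hw := weighted_unweighted measurable_subWeight hpos
  set ρ := unweighted subWeight N with hρ
  have hρac : ρ ≪ N :=
    (withDensity_absolutelyContinuous _ _).trans Measure.absolutelyContinuous_restrict
  have hρ0 : ρ {0} = 0 := unweighted_singleton_zero _ _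
  have hρae : ∀ᵐ x ∂ρ, 0 ≤ x := hρac.ae_le hNae
  have hfv : ∫⁻ x, ENNReal.ofReal (min 1 |x|) ∂ρ < ⊤ := by
    have h1 : ∫⁻ x, ENNReal.ofReal (subWeight x) ∂ρ = N {0}ᶜ := by
      rw [← setLIntegral_univ, ← withDensity_apply _ MeasurableSet.univ]
      rw [weighted] at hw
      rw [hw]
      simp
    calc _ ≤ ∫⁻ x, ENNReal.ofReal 2 * ENNReal.ofReal (subWeight x) ∂ρ := by
          refine lintegral_mono_ae ?_
          filter_upwards [hρae] with x hx
          rw [← ENNReal.ofReal_mul (by norm_num), abs_of_nonneg hx]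
          exact ENNReal.ofReal_le_ofReal (min_le_subWeight hx)
      _ < ⊤ := by
          have := measurable_subWeight
          rw [lintegral_const_mul _ (by fun_prop), h1]
          exact ENNReal.mul_lt_top ENNReal.ofReal_lt_top (measure_lt_top _ _)
  -- The kernel equals `iz` at 0, so the atom of `N` at 0 is the drift; this is why it is
  -- nonnegative.
  refine ⟨N.real {0}, ρ, measureReal_nonneg, ⟨hfv, h.1.1, le_rfl,
    isLevyMeasure_of_finite_var hρ0 hfv, fun z => ?_⟩, ?_⟩
  · rw [he, levyExponent_pair hfv]
    congr 1
    have hi : Integrable (subKernel z) N :=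
      Integrable.of_bound (continuous_subKernel z).aestronglyMeasurable _
        (.of_forall (norm_subKernel_le z))
    rw [← integral_add_compl (measurableSet_singleton (0 : ℝ)) hi, integral_singleton,
      subKernel_of_nonpos le_rfl, Complex.real_smul, mul_comm, ← hw,
      integral_weighted measurable_subWeight (hρae.mono fun x => subWeight_nonneg)]
    congr 1
    refine integral_congr_ae ?_
    filter_upwards [hρae] with x hx
    exact subKernel_mul_subWeight hx z
  · rw [← Set.Iio_union_right, measure_union_null_iff]
    exact ⟨hρac hN0, hρ0⟩

/-- Keeping only jumps of size at least `1/(n+1)` gives a compound Poisson law on `[0, ∞)` shifted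
by `β₀ ≥ 0`. These laws converge to `μ`, and the open negative half-line stays null. -/
theorem HasPair.measure_Iio {μ : Measure ℝ} {β₀ : ℝ} {ρ : Measure ℝ} (h : HasPair μ β₀ ρ)
    (hβ : 0 ≤ β₀) (hρ : ρ (Set.Iic 0) = 0) : μ (Set.Iio 0) = 0 := by
  let S : ℕ → Set ℝ := fun n => Set.Ici (1 / ((n : ℝ) + 1))
  have hε : ∀ n : ℕ, 0 < 1 / ((n : ℝ) + 1) := fun n => Nat.one_div_pos_of_nat
  have hSU : ⋃ n, S n = Set.Ioi 0 := by
    ext x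
    simp only [S, Set.mem_iUnion, Set.mem_Ici, Set.mem_Ioi]
    refine ⟨fun ⟨n, hn⟩ => (hε n).trans_le hn, fun hx => ?_⟩
    obtain ⟨n, hn⟩ := exists_nat_one_div_lt hx
    exact ⟨n, hn.le⟩
  have hSm : Monotone S := fun m n hmn =>
    Set.Ici_subset_Ici.2 (Nat.one_div_le_one_div hmn)
  have hfin : ∀ n, IsFiniteMeasure (ρ.restrict (S n)) := by
    intro n
    have hδ : (0 : ℝ) < min 1 (1 / ((n : ℝ) + 1)) := lt_min one_pos (hε n)
    refine ⟨?_⟩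
    rw [Measure.restrict_apply_univ]
    have hsub : S n ⊆ {x | ENNReal.ofReal (min 1 (1 / ((n : ℝ) + 1))) ≤ ENNReal.ofReal (min 1 |x|)} :=
      fun x hx => ENNReal.ofReal_le_ofReal (min_le_min_left _ (le_trans hx (le_abs_self x)))
    exact (measure_mono hsub).trans_lt ((meas_ge_le_lintegral_div (by fun_prop)
      (by simpa using hδ) ENNReal.ofReal_ne_top).trans_lt
        (ENNReal.div_lt_top h.finite_var.ne (by simpa using hδ)))
  have hP : ∀ n, ∃ P : Measure ℝ, IsProbabilityMeasure P ∧
      (∀ z, charFun P z = Complex.exp (Complex.I * z * β₀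
        + ∫ x in S n, (Complex.exp (Complex.I * z * (x : ℝ)) - 1) ∂ρ)) ∧ P (Set.Iio 0) = 0 := by
    intro n
    have := hfin n
    obtain ⟨P, hP, hPc, hP0⟩ := exists_compoundPoisson (ρ.restrict (S n))
    have hn0 : ρ.restrict (S n) (Set.Iio 0) = 0 := by
      refine nonpos_iff_eq_zero.1 ((Measure.restrict_apply_le _ _).trans
        ((measure_mono Set.Iio_subset_Iic_self).trans hρ.le))
    refine ⟨Measure.conv (Measure.dirac β₀) P, inferInstance, fun z => ?_,
      conv_Iio_eq_zero (by simp [hβ]) (hP0 hn0)⟩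
    rw [charFun_conv, hPc, charFun_dirac, ← Complex.exp_add, integral_exp_I_mul_sub_one]
    congr 2
    simp
    ring
  choose P hPp hPc hP0 using hP
  have hmp := h.triplet.isProb
  have hint : ∀ z : ℝ, Integrable (fun x : ℝ => Complex.exp (Complex.I * z * x) - 1) ρ := fun z =>
    integrable_of_finite_var h.finite_var (by fun_prop) (.of_forall (norm_exp_I_mul_sub_one_le z))
  have hres : ρ.restrict (Set.Ioi 0) = ρ := by
    refine Measure.restrict_eq_self_of_ae_mem ?_
    simpa [ae_iff, Set.Iic] using hρ
  obtain ⟨Q, hQ, hQc, hQ0⟩ := exists_prob_of_tendsto_charFun hPp (g := charFun μ)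
    (continuous_charFun.continuousAt) (fun z => by
      simp_rw [hPc]
      rw [h.triplet.charFun_eq, levyExponent_pair h.finite_var]
      refine (Complex.continuous_exp.tendsto _).comp (tendsto_const_nhds.add ?_)
      have := tendsto_setIntegral_of_monotone (μ := ρ) (fun n => measurableSet_Ici) hSm
        (hint z).integrableOn
      rwa [hSU, hres] at this)
  rw [← Measure.ext_of_charFun (funext hQc)]
  exact hQ0 _ isOpen_Iio hP0

/-! ### Convolution powers: measurability and small-time bounds -/

/-- Such a family is weakly continuous, so `s ↦ κ s U` is lower semicontinuous for open `U`, and the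
open sets form a generating π-system. -/
theorem measurable_of_continuous_charFun {κ : ℝ → Measure ℝ}
    (hκ : ∀ s, IsProbabilityMeasure (κ s)) (h : ∀ z, Continuous fun s => charFun (κ s) z) :
    Measurable κ := by
  let K : ℝ → ProbabilityMeasure ℝ := fun s => ⟨κ s, hκ s⟩
  have hK : Continuous K := by
    refine SeqContinuous.continuous fun u s hu => ?_
    exact ProbabilityMeasure.tendsto_iff_tendsto_charFun.2 fun z => ((h z).tendsto s).comp hu
  refine Measurable.measure_of_isPiSystem_of_isProbabilityMeasure
    (BorelSpace.measurable_eq : _ = borel ℝ) isPiSystem_isOpen fun U hU => ?_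
  have : LowerSemicontinuous fun s => κ s U := by
    intro s
    refine lowerSemicontinuousAt_iff_le_liminf.2 ?_
    exact ProbabilityMeasure.le_liminf_measure_open_of_tendsto (hK.tendsto s) hU
  exact this.measurable

theorem exists_measurable_convPowers {γ b : ℝ} (hb : 0 ≤ b) {ν : Measure ℝ} (hν : IsLevyMeasure ν) :
    ∃ κ : ℝ → Measure ℝ, IsConvPowers γ b ν κ ∧ Measurable κ ∧ ∀ s, IsProbabilityMeasure (κ s) := by
  have := hν.isFiniteMeasure_canonicalMeasure b
  -- `max s 0` extends the powers to a continuous family on all of `ℝ`.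
  have h : ∀ s : ℝ, ∃ P : Measure ℝ, IsProbabilityMeasure P ∧
      ∀ z, charFun P z = Complex.exp ((max s 0 : ℝ) * levyExponent γ b ν z) := by
    intro s
    obtain ⟨P, hP, h⟩ := exists_prob_smul_canonicalExponent (sinDrift γ ν) (canonicalMeasure b ν)
      (le_max_right s 0)
    exact ⟨P, hP, fun z => by rw [h, levyExponent_eq_canonicalExponent hb hν]⟩
  choose κ hκ hκc using h
  refine ⟨κ, fun s hs => ⟨hκ s, fun z => by rw [hκc, max_eq_left hs]⟩, ?_, hκ⟩
  refine measurable_of_continuous_charFun hκ fun z => ?_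
  simp_rw [hκc]
  fun_prop

theorem IsConvPowers.eq {γ b : ℝ} {ν : Measure ℝ} {κ κ' : ℝ → Measure ℝ}
    (h : IsConvPowers γ b ν κ) (h' : IsConvPowers γ b ν κ') {s : ℝ} (hs : 0 ≤ s) : κ s = κ' s := by
  have := (h s hs).1
  have := (h' s hs).1
  exact Measure.ext_of_charFun (funext fun z => by rw [(h s hs).2, (h' s hs).2])

theorem continuous_levyExponent {γ b : ℝ} (hb : 0 ≤ b) {ν : Measure ℝ} (hν : IsLevyMeasure ν) :
    Continuous (levyExponent γ b ν) := by
  have := hν.isFiniteMeasure_canonicalMeasure b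
  rw [funext (levyExponent_eq_canonicalExponent (γ := γ) hb hν)]
  exact continuous_canonicalExponent _ _

theorem norm_charFun_sub_one_le {κ : Measure ℝ} [IsProbabilityMeasure κ] {s : ℝ} (hs : 0 ≤ s) {w : ℂ}
    {z : ℝ} (h : charFun κ z = Complex.exp (s * w)) : ‖charFun κ z - 1‖ ≤ s * ‖w‖ := by
  have hre : ((s : ℂ) * w).re ≤ 0 := by
    have h1 := norm_charFun_le_one (μ := κ) z
    rwa [h, Complex.norm_exp, Real.exp_le_one_iff] at h1
  rw [h]
  refine (norm_exp_sub_one_le_of_re_nonpos hre).trans ?_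
  rw [norm_mul, Complex.norm_real, Real.norm_of_nonneg hs]

theorem integrable_levyWeight (κ : Measure ℝ) [IsFiniteMeasure κ] : Integrable levyWeight κ :=
  Integrable.of_bound continuous_levyWeight.aestronglyMeasurable 2 (.of_forall fun x => by
    rw [Real.norm_of_nonneg (levyWeight_nonneg x)]
    exact levyWeight_le_two x)

/-- `sinc x` is the average of `e^{izx}` over `z ∈ [-1, 1]`; bounds on the characteristic function
there thus control the weight. -/
theorem integral_levyWeight_eq (κ : Measure ℝ) [IsProbabilityMeasure κ] :
    ((∫ x, levyWeight x ∂κ : ℝ) : ℂ) = (1 / 2 : ℂ) * ∫ z in (-1 : ℝ)..1, (1 - charFun κ z) := by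
  have h1 := integral_charFun_Icc (μ := κ) one_pos
  have hc := continuous_charFun (μ := κ)
  rw [intervalIntegral.integral_sub (Continuous.intervalIntegrable (by fun_prop) _ _)
    (hc.intervalIntegrable _ _), h1]
  unfold levyWeight
  rw [integral_sub (integrable_const _) Real.integrable_sinc]
  simp
  ring

theorem integral_sin_eq (κ : Measure ℝ) [IsProbabilityMeasure κ] :
    ∫ x, Real.sin x ∂κ = (charFun κ 1).im := by
  have hi : Integrable (fun x : ℝ => Complex.exp ((1 : ℝ) * x * Complex.I)) κ := by
    refine Integrable.of_bound (by fun_prop) 1 (.of_forall fun x => ?_)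
    rw [← Complex.ofReal_mul, Complex.norm_exp_ofReal_mul_I]
  rw [charFun_apply_real]
  rw [show (∫ x : ℝ, Complex.exp ((1 : ℝ) * x * Complex.I) ∂κ).im
      = ∫ x : ℝ, (Complex.exp ((1 : ℝ) * x * Complex.I)).im ∂κ from (integral_im hi).symm]
  refine integral_congr_ae (.of_forall fun x => ?_)
  simp only
  rw [← Complex.ofReal_mul, Complex.exp_ofReal_mul_I_im, one_mul]

theorem integrable_trunc (κ : Measure ℝ) [IsFiniteMeasure κ] : Integrable trunc κ :=
  Integrable.of_bound measurable_trunc.aestronglyMeasurable 1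
    (.of_forall fun x => (abs_trunc_le x).trans (min_le_left _ _))

/-- Small time bounds for the convolution powers. -/
theorem exists_convPowers_bound {γ b : ℝ} (hb : 0 ≤ b) {ν : Measure ℝ} (hν : IsLevyMeasure ν) :
    ∃ C : ℝ, 0 ≤ C ∧ ∀ κ : ℝ → Measure ℝ, IsConvPowers γ b ν κ → ∀ s, 0 ≤ s →
      ∫ x, levyWeight x ∂(κ s) ≤ C * s ∧ |∫ x, trunc x ∂(κ s)| ≤ C * s := by
  obtain ⟨C, hC⟩ := (isCompact_Icc (a := (-1 : ℝ)) (b := 1)).exists_bound_of_continuousOn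
    (continuous_levyExponent (γ := γ) hb hν).continuousOn
  have hC0 : 0 ≤ C := (norm_nonneg _).trans (hC 0 (by simp))
  -- `∫ sin` contributes `C` and `|sin - τ| ≤ 40 levyWeight` contributes `40 C`.
  refine ⟨41 * C, by positivity, fun κ hκ s hs => ?_⟩
  have hP := (hκ s hs).1
  have h1 : ∫ x, levyWeight x ∂(κ s) ≤ C * s := by
    have h2 : ‖∫ z in (-1 : ℝ)..1, (1 - charFun (κ s) z)‖ ≤ s * C * |1 - (-1)| := by
      refine intervalIntegral.norm_integral_le_of_norm_le_const fun z hz => ?_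
      rw [Set.uIoc_of_le (by norm_num)] at hz
      rw [norm_sub_rev]
      exact (norm_charFun_sub_one_le hs ((hκ s hs).2 z)).trans
        (mul_le_mul_of_nonneg_left (hC z ⟨hz.1.le, hz.2⟩) hs)
    have h3 := congrArg norm (integral_levyWeight_eq (κ s))
    rw [Complex.norm_real, Real.norm_of_nonneg (integral_nonneg levyWeight_nonneg), norm_mul] at h3
    rw [h3]
    norm_num at h2 ⊢
    linarith
  refine ⟨h1.trans (by nlinarith), ?_⟩
  have hsin : Integrable Real.sin (κ s) := Integrable.of_bound (by fun_prop) 1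
    (.of_forall fun x => Real.abs_sin_le_one x)
  have h2 : |∫ x, Real.sin x ∂(κ s)| ≤ C * s := by
    rw [integral_sin_eq]
    have h3 : (charFun (κ s) 1).im = (charFun (κ s) 1 - 1).im := by simp
    rw [h3]
    refine (Complex.abs_im_le_norm _).trans ((norm_charFun_sub_one_le hs ((hκ s hs).2 1)).trans ?_)
    rw [mul_comm C]
    exact mul_le_mul_of_nonneg_left (hC 1 (by simp)) hs
  have h3 : |∫ x, (Real.sin x - trunc x) ∂(κ s)| ≤ 40 * (C * s) := by
    calc _ ≤ ∫ x, |Real.sin x - trunc x| ∂(κ s) := abs_integral_le_integral_abs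
      _ ≤ ∫ x, 40 * levyWeight x ∂(κ s) := by
          refine integral_mono (hsin.sub (integrable_trunc _)).abs
            ((integrable_levyWeight _).const_mul _) fun x => ?_
          exact (abs_sin_sub_trunc_le x).trans (min_le_levyWeight x)
      _ ≤ _ := by
          rw [integral_const_mul]
          linarith
  rw [integral_sub hsin (integrable_trunc _)] at h3
  have h4 := abs_le.1 h2
  have h5 := abs_le.1 h3
  exact abs_le.2 ⟨by linarith, by linarith⟩

/-! ### The map `Λ`: existence, uniqueness, domains -/

theorem IsLevyMeasure.zero : IsLevyMeasure (0 : Measure ℝ) := by simp [IsLevyMeasure]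

theorem exists_isSubTriplet {γ b β₀ : ℝ} {ν ρ : Measure ℝ} (hb : 0 ≤ b) (hν : IsLevyMeasure ν)
    (hβ : 0 ≤ β₀) (hρ : ∫⁻ x, ENNReal.ofReal (min 1 |x|) ∂ρ < ⊤) :
    ∃ γ' b' ν', 0 ≤ b' ∧ IsLevyMeasure ν' ∧ IsSubTriplet γ b ν β₀ ρ γ' b' ν' := by
  obtain ⟨κ, hκ, hκm, hκp⟩ := exists_measurable_convPowers (γ := γ) hb hν
  obtain ⟨C, hC0, hC⟩ := exists_convPowers_bound (γ := γ) hb hν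
  have hρ' : ∫⁻ x in Set.Ioi 0, ENNReal.ofReal (min 1 |x|) ∂ρ < ⊤ :=
    (setLIntegral_le_lintegral _ _).trans_lt hρ
  have h0 : (0 : ℝ) ∉ ({0}ᶜ : Set ℝ) := by simp
  refine ⟨γ * β₀ + ∫ s in Set.Ioi (0 : ℝ), (∫ x in {x : ℝ | |x| ≤ 1}, x ∂(κ s)) ∂ρ, b * β₀,
    -- The mixture of the powers may have an atom at 0, which a Lévy measure must not have.
    (ENNReal.ofReal β₀ • ν + (ρ.restrict (Set.Ioi 0)).bind κ).restrict {0}ᶜ, by positivity,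
    ⟨by simp [Measure.restrict_apply], ?_⟩, κ, hκ, rfl, ?_, rfl, fun _ => hβ, fun A hA hA0 => ?_⟩
  · refine (lintegral_mono' Measure.restrict_le_self le_rfl).trans_lt ?_
    rw [lintegral_add_measure, lintegral_smul_measure,
      Measure.lintegral_bind hκm.aemeasurable (by fun_prop)]
    refine ENNReal.add_lt_top.2 ⟨ENNReal.mul_lt_top ENNReal.ofReal_lt_top hν.2, ?_⟩
    -- For `s ≤ 1` the small-time bound `40 C s` is used, for `s ≥ 1` the trivial bound 1.
    calc _ ≤ ∫⁻ s in Set.Ioi 0, ENNReal.ofReal (40 * C + 1) * ENNReal.ofReal (min 1 |s|) ∂ρ := by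
          refine setLIntegral_mono' measurableSet_Ioi fun s hs => ?_
          have hs0 : 0 < s := hs
          have hP := hκp s
          have hi : Integrable (fun x : ℝ => min 1 (|x| ^ 2)) (κ s) :=
            Integrable.of_bound (by fun_prop) 1 (.of_forall fun x => by
              rw [Real.norm_of_nonneg (by positivity)]
              exact min_le_left _ _)
          rw [← ofReal_integral_eq_lintegral_ofReal hi (.of_forall fun x => by positivity),
            ← ENNReal.ofReal_mul (by positivity), abs_of_pos hs0]
          refine ENNReal.ofReal_le_ofReal ?_
          have h1 : ∫ x : ℝ, min 1 (|x| ^ 2) ∂(κ s) ≤ 1 := by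
            have := integral_mono hi (integrable_const (1 : ℝ)) fun x => min_le_left _ _
            simpa using this
          have h2 : ∫ x : ℝ, min 1 (|x| ^ 2) ∂(κ s) ≤ 40 * (C * s) := by
            refine (integral_mono hi ((integrable_levyWeight (κ s)).const_mul 40)
              fun x => min_le_levyWeight x).trans ?_
            rw [integral_const_mul]
            linarith [(hC κ hκ s hs0.le).1]
          rcases le_total s 1 with h | h
          · rw [min_eq_right h]
            nlinarith
          · rw [min_eq_left h]
            linarith
      _ < ⊤ := by
          rw [lintegral_const_mul _ (by fun_prop)]
          exact ENNReal.mul_lt_top ENNReal.ofReal_lt_top hρ'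
  · have hm : StronglyMeasurable fun s => ∫ x, trunc x ∂(κ s) := by
      let K : Kernel ℝ ℝ := ⟨κ, hκm⟩
      have : IsMarkovKernel K := ⟨hκp⟩
      exact StronglyMeasurable.integral_kernel (κ := K) measurable_trunc.stronglyMeasurable
    simp_rw [← integral_trunc]
    refine integrable_of_finite_var (C := C + 1) hρ' hm.aestronglyMeasurable ?_
    filter_upwards [ae_restrict_mem measurableSet_Ioi] with s hs
    have hs0 : 0 < s := hs
    have hP := hκp s
    rw [abs_of_pos hs0, Real.norm_eq_abs]
    have h1 : |∫ x, trunc x ∂(κ s)| ≤ 1 := by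
      have := norm_integral_le_of_norm_le_const (μ := κ s) (f := trunc) (C := 1)
        (.of_forall fun x => (abs_trunc_le x).trans (min_le_left _ _))
      simpa using this
    have h2 := (hC κ hκ s hs0.le).2
    rcases le_total s 1 with h | h
    · rw [min_eq_right h]
      nlinarith
    · rw [min_eq_left h]
      linarith
  · have hA' : A ∩ {0}ᶜ = A := Set.inter_eq_left.2 fun x hx hx0 => hA0 (hx0 ▸ hx)
    rw [Measure.restrict_apply hA, hA', Measure.add_apply, Measure.smul_apply, smul_eq_mul,
      Measure.bind_apply hA hκm.aemeasurable]

theorem IsSubTriplet.unique {γ b β₀ γ₁ b₁ γ₂ b₂ : ℝ} {ν ρ ν₁ ν₂ : Measure ℝ}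
    (h₁ : IsSubTriplet γ b ν β₀ ρ γ₁ b₁ ν₁) (h₂ : IsSubTriplet γ b ν β₀ ρ γ₂ b₂ ν₂)
    (hν₁ : ν₁ {0} = 0) (hν₂ : ν₂ {0} = 0) : γ₁ = γ₂ ∧ b₁ = b₂ ∧ ν₁ = ν₂ := by
  obtain ⟨κ, hκ, hb, -, hγ, -, hA⟩ := h₁
  obtain ⟨κ', hκ', hb', -, hγ', -, hA'⟩ := h₂
  refine ⟨?_, hb.trans hb'.symm, ?_⟩
  · rw [hγ, hγ']
    congr 1
    refine setIntegral_congr_fun measurableSet_Ioi fun s hs => ?_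
    rw [hκ.eq hκ' (le_of_lt hs)]
  · ext A hAm
    rw [← measure_sdiff_null hν₁, ← measure_sdiff_null (s := A) hν₂,
      hA _ (hAm.diff (measurableSet_singleton 0)) (by simp),
      hA' _ (hAm.diff (measurableSet_singleton 0)) (by simp)]
    congr 1
    refine setLIntegral_congr_fun measurableSet_Ioi fun s hs => ?_
    rw [hκ.eq hκ' (le_of_lt hs)]

theorem HasPair.unique {μ : Measure ℝ} {β β' : ℝ} {ρ ρ' : Measure ℝ} (h : HasPair μ β ρ)
    (h' : HasPair μ β' ρ') : β = β' ∧ ρ = ρ' := by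
  obtain ⟨h1, -, rfl⟩ := h.triplet.unique h'.triplet
  exact ⟨by simpa using h1, rfl⟩

/-- The graph of `Λ` in terms of given characteristics of `μ_L` and `μ_T`. -/
theorem LambdaGraph.exists_of {μL μT μ' : Measure ℝ} (h : LambdaGraph μL μT μ') {γ b : ℝ}
    {ν : Measure ℝ} (hL : HasTriplet μL γ b ν) {β₀ : ℝ} {ρ : Measure ℝ} (hT : HasPair μT β₀ ρ) :
    ∃ γ' b' ν', IsSubTriplet γ b ν β₀ ρ γ' b' ν' ∧ HasTriplet μ' γ' b' ν' := by
  obtain ⟨-, -, -, γ₁, b₁, ν₁, β₁, ρ₁, γ', b', ν', h1, h2, -, h3, h4⟩ := h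
  obtain ⟨rfl, rfl, rfl⟩ := h1.unique hL
  obtain ⟨rfl, rfl⟩ := h2.unique hT
  exact ⟨γ', b', ν', h3, h4⟩

theorem LambdaGraph.unique {μL μT μ₁ μ₂ : Measure ℝ} (h₁ : LambdaGraph μL μT μ₁)
    (h₂ : LambdaGraph μL μT μ₂) : μ₁ = μ₂ := by
  obtain ⟨-, -, -, γ, b, ν, β, ρ, γ', b', ν', h1, h2, -, h3, h4⟩ := h₁
  obtain ⟨γ'', b'', ν'', h5, h6⟩ := h₂.exists_of h1 h2
  obtain ⟨rfl, rfl, rfl⟩ := h3.unique h5 h4.levy.1 h6.levy.1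
  exact h4.eq h6

theorem LambdaGraph.lambda_eq {μL μT μ' : Measure ℝ} (h : LambdaGraph μL μT μ') :
    Lambda μL μT = μ' := by
  have hex : ∃ μ', LambdaGraph μL μT μ' := ⟨μ', h⟩
  rw [Lambda, dif_pos hex]
  exact hex.choose_spec.unique h

theorem exists_lambdaGraph {μL μT : Measure ℝ} (hL : μL ∈ ID) (hT : μT ∈ IDplus) :
    ∃ μ', LambdaGraph μL μT μ' := by
  obtain ⟨γ, b, ν, h1⟩ := exists_hasTriplet_of_mem_ID hL
  obtain ⟨β, ρ, hβ, h2, hρ⟩ := exists_hasPair_of_mem_IDplus hT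
  obtain ⟨γ', b', ν', hb', hν', h3⟩ :=
    exists_isSubTriplet (γ := γ) h1.gauss_nonneg h1.levy hβ h2.finite_var
  obtain ⟨μ', h4⟩ := exists_hasTriplet γ' hb' hν'
  exact ⟨μ', hL, hT.1, h4.mem_ID, γ, b, ν, β, ρ, γ', b', ν', h1, h2, hρ, h3, h4⟩

theorem mem_rangeL {μL μ' : Measure ℝ} : μ' ∈ rangeL μL ↔ ∃ μT, LambdaGraph μL μT μ' := by
  constructor
  · rintro ⟨μT, ⟨η, hη⟩, rfl⟩
    simp only
    rw [hη.lambda_eq]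
    exact ⟨μT, hη⟩
  · rintro ⟨μT, h⟩
    exact ⟨μT, ⟨μ', h⟩, h.lambda_eq⟩

theorem mem_rangeT {μT μ' : Measure ℝ} : μ' ∈ rangeT μT ↔ ∃ μL, LambdaGraph μL μT μ' := by
  constructor
  · rintro ⟨μL, ⟨η, hη⟩, rfl⟩
    simp only
    rw [hη.lambda_eq]
    exact ⟨μL, hη⟩
  · rintro ⟨μL, h⟩
    exact ⟨μL, ⟨μ', h⟩, h.lambda_eq⟩

theorem hasTriplet_dirac (c : ℝ) : HasTriplet (Measure.dirac c) c 0 0 := by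
  refine ⟨inferInstance, le_rfl, .zero, fun z => ?_⟩
  rw [charFun_dirac, levyExponent]
  congr 1
  simp
  ring

/-- Only `β₀ ≥ 0` is at stake. It is part of the definition when `ν ≠ 0`; otherwise nondegeneracy
forces `b > 0`, and `b β₀` is a variance. -/
theorem mem_IDplus_of_lambdaGraph {μL μT μ' : Measure ℝ} (hL : Nondegenerate μL)
    (h : LambdaGraph μL μT μ') : μT ∈ IDplus := by
  obtain ⟨-, hT, -, γ, b, ν, β, ρ, γ', b', ν', h1, h2, hρ, h3, h4⟩ := h
  refine ⟨hT, h2.measure_Iio ?_ hρ⟩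
  obtain ⟨κ, -, hb, -, -, hβ, -⟩ := h3
  by_cases hν : ν = 0
  · subst hν
    have hb0 : 0 < b := by
      refine lt_of_le_of_ne h1.gauss_nonneg fun hb0 => hL γ ?_
      subst hb0
      exact h1.eq (hasTriplet_dirac γ)
    refine nonneg_of_mul_nonneg_right ?_ hb0
    rw [← hb]
    exact h4.gauss_nonneg
  · exact hβ hν

/-! ### The ranges are proper -/

/-- With a Gaussian part in `μ_L`, a vanishing Lévy measure of the image forces `ρ = 0`. -/
theorem IsSubTriplet.eq_zero {γ b β₀ γ' b' : ℝ} {ν ρ : Measure ℝ} (hb : 0 < b)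
    (hν : IsLevyMeasure ν) (hρ : ρ (Set.Iic 0) = 0) (h : IsSubTriplet γ b ν β₀ ρ γ' b' 0) :
    ρ = 0 := by
  obtain ⟨κ, hκ, -, -, -, -, hA⟩ := h
  obtain ⟨κ', hκ', hκm, hκp⟩ := exists_measurable_convPowers (γ := γ) hb.le hν
  have h1 := hA {0}ᶜ (measurableSet_singleton 0).compl (by simp)
  have h2 : ∫⁻ s in Set.Ioi (0 : ℝ), κ' s {0}ᶜ ∂ρ = 0 := by
    rw [← nonpos_iff_eq_zero]
    calc ∫⁻ s in Set.Ioi (0 : ℝ), κ' s {0}ᶜ ∂ρ = ∫⁻ s in Set.Ioi (0 : ℝ), κ s {0}ᶜ ∂ρ := by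
          refine setLIntegral_congr_fun measurableSet_Ioi fun s hs => ?_
          rw [hκ.eq hκ' (le_of_lt hs)]
      _ ≤ _ := le_add_self
      _ = 0 := by
          rw [← h1]
          simp
  rw [lintegral_eq_zero_iff (Measure.measurable_measure.1 hκm _ (measurableSet_singleton 0).compl)]
    at h2
  -- If `μ^s = δ₀`, the exponent vanishes, hence so does the canonical measure, contradicting its
  -- atom `b/6 > 0`.
  have hne : ∀ s, 0 < s → κ' s {0}ᶜ ≠ 0 := by
    intro s hs h0
    have hP := hκp s
    have hd : κ' s = Measure.dirac 0 := by
      have hae : ∀ᵐ x ∂(κ' s), x = 0 := h0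
      refine Measure.ext_of_charFun (funext fun z => ?_)
      rw [charFun_apply_real, charFun_dirac]
      calc _ = ∫ x : ℝ, (1 : ℂ) ∂(κ' s) := by
            refine integral_congr_ae ?_
            filter_upwards [hae] with x hx
            simp [hx]
        _ = _ := by simp
    have hM := hν.isFiniteMeasure_canonicalMeasure b
    have h3 : (fun z => s * levyExponent γ b ν z) = fun _ => 0 := by
      refine eq_of_exp_eq (continuous_const.mul (continuous_levyExponent hb.le hν)) continuous_const
        ?_ fun z => ?_
      · rw [levyExponent_eq_canonicalExponent hb.le hν]
        simp
      · rw [← (hκ' s hs.le).2, hd, charFun_dirac]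
        simp
    have h4 : ∀ z, canonicalExponent (sinDrift γ ν) (canonicalMeasure b ν) z
        = canonicalExponent 0 0 z := by
      intro z
      have := congrFun h3 z
      rw [← levyExponent_eq_canonicalExponent hb.le hν]
      have hsc : (s : ℂ) ≠ 0 := by exact_mod_cast hs.ne'
      rw [(mul_eq_zero.1 this).resolve_left hsc]
      simp [canonicalExponent]
    have h5 := canonicalMeasure_singleton_zero b ν
    rw [(canonicalExponent_injective h4).2] at h5
    have h6 := ENNReal.ofReal_eq_zero.1 h5.symm
    linarith
  have h3 : ρ (Set.Ioi 0) = 0 := by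
    rw [← Measure.restrict_apply_univ, Measure.measure_univ_eq_zero, ← ae_eq_bot,
      ← Filter.eventually_false_iff_eq_bot]
    filter_upwards [h2, ae_restrict_mem measurableSet_Ioi] with s hs hs0
    exact hne s hs0 hs
  rw [← Measure.measure_univ_eq_zero, ← Set.Iic_union_Ioi (a := (0 : ℝ)), measure_union_null_iff]
  exact ⟨hρ, h3⟩

theorem rangeL_ssubset {μL : Measure ℝ} (hL : μL ∈ ID) : rangeL μL ⊂ ID := by
  have hsub : rangeL μL ⊆ ID := fun μ hμ => by
    obtain ⟨μT, h⟩ := mem_rangeL.1 hμ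
    exact h.2.2.1
  obtain ⟨γ, b, ν, h1⟩ := exists_hasTriplet_of_mem_ID hL
  -- Variance 1 forces `β₀ = 1/b` and `ρ = 0`, hence mean `γ/b`, which this law avoids. If `b = 0`
  -- the mean is irrelevant, as variance 1 is already out of reach.
  obtain ⟨η, hη⟩ := exists_hasTriplet (γ / b + 1) zero_le_one IsLevyMeasure.zero
  refine (Set.ssubset_iff_of_subset hsub).2 ⟨η, hη.mem_ID, fun hmem => ?_⟩
  obtain ⟨μT, h⟩ := mem_rangeL.1 hmem
  obtain ⟨-, -, -, γ₁, b₁, ν₁, β, ρ, γ', b', ν', h1', h2, hρ, h3, h4⟩ := h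
  obtain ⟨rfl, rfl, rfl⟩ := h1'.unique h1
  obtain ⟨rfl, rfl, rfl⟩ := h4.unique hη
  have hbβ : 1 = b₁ * β := h3.choose_spec.2.1
  have hb0 : b₁ ≠ 0 := by
    rintro rfl
    simp at hbβ
  have hρ0 := h3.eq_zero (lt_of_le_of_ne h1.gauss_nonneg hb0.symm) h1.levy hρ
  subst hρ0
  obtain ⟨κ, -, -, -, hγ, -, -⟩ := h3
  have hβ : β = 1 / b₁ := by
    field_simp
    linarith
  rw [hβ] at hγ
  simp at hγ
  rw [div_eq_mul_inv] at hγ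
  linarith

/-- The standard normal law is missed: reaching it needs `b > 0`, hence `ρ = 0`, and then `μ_T` is a
point mass. -/
theorem rangeT_ssubset {μT : Measure ℝ} (hT : Nondegenerate μT) : rangeT μT ⊂ ID := by
  have hsub : rangeT μT ⊆ ID := fun μ hμ => by
    obtain ⟨μL, h⟩ := mem_rangeT.1 hμ
    exact h.2.2.1
  obtain ⟨η, hη⟩ := exists_hasTriplet 0 zero_le_one IsLevyMeasure.zero
  refine (Set.ssubset_iff_of_subset hsub).2 ⟨η, hη.mem_ID, fun hmem => ?_⟩
  obtain ⟨μL, h⟩ := mem_rangeT.1 hmem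
  obtain ⟨-, -, -, γ, b, ν, β, ρ, γ', b', ν', h1, h2, hρ, h3, h4⟩ := h
  obtain ⟨rfl, rfl, rfl⟩ := h4.unique hη
  have hbβ : 1 = b * β := h3.choose_spec.2.1
  have hb0 : b ≠ 0 := by
    rintro rfl
    simp at hbβ
  have hρ0 := h3.eq_zero (lt_of_le_of_ne h1.gauss_nonneg hb0.symm) h1.levy hρ
  subst hρ0
  refine hT β (HasTriplet.eq (γ := β) (b := 0) (ν := 0) ?_ (hasTriplet_dirac β))
  simpa using h2.triplet

/-! ### Additivity and convolution -/

theorem IsLevyMeasure.add {ν₁ ν₂ : Measure ℝ} (h₁ : IsLevyMeasure ν₁) (h₂ : IsLevyMeasure ν₂) :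
    IsLevyMeasure (ν₁ + ν₂) := by
  refine ⟨by simp [h₁.1, h₂.1], ?_⟩
  rw [lintegral_add_measure]
  exact ENNReal.add_lt_top.2 ⟨h₁.2, h₂.2⟩

theorem IsLevyMeasure.integrable_compensated {ν : Measure ℝ} (hν : IsLevyMeasure ν) (z : ℝ) :
    Integrable (fun x : ℝ => Complex.exp (Complex.I * z * x) - 1 - Complex.I * trunc x * z) ν := by
  have h1 : Integrable (sinCompensated z) ν :=
    hν.integrable (continuous_sinCompensated z).aestronglyMeasurable (norm_sinCompensated_le z)
  have h2 : Integrable (fun x => Real.sin x - trunc x) ν :=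
    hν.integrable (C := 1) (Real.measurable_sin.sub measurable_trunc).aestronglyMeasurable
      fun x => by
        rw [one_mul]
        exact abs_sin_sub_trunc_le x
  have h2' : Integrable (fun x => ((Real.sin x - trunc x : ℝ) : ℂ)) ν := h2.ofReal
  refine (h1.add (h2'.const_mul (Complex.I * z))).congr (.of_forall fun x => ?_)
  simp only [Pi.add_apply, sinCompensated]
  push_cast
  ring

theorem HasTriplet.conv {μ₁ μ₂ : Measure ℝ} {γ₁ b₁ γ₂ b₂ : ℝ} {ν₁ ν₂ : Measure ℝ}
    (h₁ : HasTriplet μ₁ γ₁ b₁ ν₁) (h₂ : HasTriplet μ₂ γ₂ b₂ ν₂) :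
    HasTriplet (Measure.conv μ₁ μ₂) (γ₁ + γ₂) (b₁ + b₂) (ν₁ + ν₂) := by
  have := h₁.isProb
  have := h₂.isProb
  refine ⟨inferInstance, add_nonneg h₁.gauss_nonneg h₂.gauss_nonneg, h₁.levy.add h₂.levy,
    fun z => ?_⟩
  rw [charFun_conv, h₁.charFun_eq, h₂.charFun_eq, ← Complex.exp_add]
  congr 1
  unfold levyExponent
  rw [integral_add_measure (h₁.levy.integrable_compensated z) (h₂.levy.integrable_compensated z)]
  push_cast
  ring

theorem HasPair.conv {μ₁ μ₂ : Measure ℝ} {β₁ β₂ : ℝ} {ρ₁ ρ₂ : Measure ℝ}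
    (h₁ : HasPair μ₁ β₁ ρ₁) (h₂ : HasPair μ₂ β₂ ρ₂) :
    HasPair (Measure.conv μ₁ μ₂) (β₁ + β₂) (ρ₁ + ρ₂) := by
  have hi : ∀ {μ β ρ}, HasPair μ β ρ → Integrable (fun x : ℝ => x)
      (ρ.restrict {x : ℝ | |x| ≤ 1}) := by
    intro μ β ρ h
    refine integrable_of_finite_var (C := 1) ((setLIntegral_le_lintegral _ _).trans_lt h.finite_var)
      (by fun_prop) ?_
    filter_upwards [ae_restrict_mem (measurableSet_le (by fun_prop) (by fun_prop))] with x hx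
    rw [one_mul]
    exact le_min hx le_rfl
  refine ⟨?_, ?_⟩
  · rw [lintegral_add_measure]
    exact ENNReal.add_lt_top.2 ⟨h₁.finite_var, h₂.finite_var⟩
  · have := h₁.triplet.conv h₂.triplet
    rw [Measure.restrict_add, integral_add_measure (hi h₁) (hi h₂)]
    convert! this using 1
    · ring
    · simp

theorem IsSubTriplet.add {γ b β₁ β₂ γ₁ b₁ γ₂ b₂ : ℝ} {ν ρ₁ ρ₂ ν₁ ν₂ : Measure ℝ}
    (h₁ : IsSubTriplet γ b ν β₁ ρ₁ γ₁ b₁ ν₁) (h₂ : IsSubTriplet γ b ν β₂ ρ₂ γ₂ b₂ ν₂) :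
    IsSubTriplet γ b ν (β₁ + β₂) (ρ₁ + ρ₂) (γ₁ + γ₂) (b₁ + b₂) (ν₁ + ν₂) := by
  obtain ⟨κ, hκ, hb, hi, hγ, hβ, hA⟩ := h₁
  obtain ⟨κ', hκ', hb', hi', hγ', hβ', hA'⟩ := h₂
  have heq : Set.EqOn (fun s : ℝ => ∫ x in {x : ℝ | |x| ≤ 1}, x ∂(κ' s))
      (fun s : ℝ => ∫ x in {x : ℝ | |x| ≤ 1}, x ∂(κ s)) (Set.Ioi 0) := fun s hs => by
    simp only
    rw [hκ.eq hκ' (le_of_lt hs)]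
  have hi'' := hi'.congr_fun heq measurableSet_Ioi
  rw [setIntegral_congr_fun measurableSet_Ioi heq] at hγ'
  refine ⟨κ, hκ, by rw [hb, hb']; ring, ?_, ?_, fun h => add_nonneg (hβ h) (hβ' h),
    fun A hAm hA0 => ?_⟩
  · exact hi.add_measure hi''
  · rw [Measure.restrict_add, integral_add_measure hi hi'', hγ, hγ']
    ring
  · have hκA : ∫⁻ s in Set.Ioi (0 : ℝ), κ' s A ∂ρ₂ = ∫⁻ s in Set.Ioi (0 : ℝ), κ s A ∂ρ₂ := by
      refine setLIntegral_congr_fun measurableSet_Ioi fun s hs => ?_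
      rw [hκ.eq hκ' (le_of_lt hs)]
    rw [Measure.add_apply, hA A hAm hA0, hA' A hAm hA0, hκA, Measure.restrict_add,
      lintegral_add_measure]
    -- `ENNReal.ofReal` truncates at 0, so additivity needs nonnegative drifts. These are guaranteed
    -- when `ν ≠ 0`; otherwise the term vanishes.
    by_cases hν : ν = 0
    · simp [hν]
    · rw [ENNReal.ofReal_add (hβ hν) (hβ' hν), add_mul]
      exact add_add_add_comm _ _ _ _

theorem LambdaGraph.conv {μL μ₁ μ₂ η₁ η₂ : Measure ℝ} (h₁ : LambdaGraph μL μ₁ η₁)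
    (h₂ : LambdaGraph μL μ₂ η₂) :
    LambdaGraph μL (Measure.conv μ₁ μ₂) (Measure.conv η₁ η₂) := by
  obtain ⟨hL, hT₁, hη₁, γ, b, ν, β₁, ρ₁, γ₁, b₁, ν₁, a1, a2, a3, a4, a5⟩ := h₁
  obtain ⟨-, hT₂, hη₂, γ', b', ν', β₂, ρ₂, γ₂, b₂, ν₂, c1, c2, c3, c4, c5⟩ := h₂
  obtain ⟨rfl, rfl, rfl⟩ := c1.unique a1
  exact ⟨hL, conv_mem_ID hT₁ hT₂, conv_mem_ID hη₁ hη₂, _, _, _, _, _, _, _, _, a1, a2.conv c2,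
    by simp [a3, c3], a4.add c4, a5.conv c5⟩

/-! ### The Poisson counterexample and the conclusion -/

/-- The range of `Λ` at a Poisson law is not closed under convolution. -/
theorem exists_rangeT_not_convClosed : ∃ μT ∈ IDplus, ¬ ConvClosed (rangeT μT) := by
  have hfv : ∫⁻ x, ENNReal.ofReal (min 1 |x|) ∂(Measure.dirac (1 : ℝ)) < ⊤ := by simp
  have hlevy : IsLevyMeasure (Measure.dirac (1 : ℝ)) := isLevyMeasure_of_finite_var (by simp) hfv
  obtain ⟨μT, hμT⟩ := exists_hasTriplet
    (0 + ∫ x in {x : ℝ | |x| ≤ 1}, x ∂(Measure.dirac (1 : ℝ))) le_rfl hlevy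
  have hpair : HasPair μT 0 (Measure.dirac 1) := ⟨hfv, hμT⟩
  have hT : μT ∈ IDplus := ⟨hμT.mem_ID, hpair.measure_Iio le_rfl (by simp)⟩
  -- With `β₀ = 0` and `ρ = δ₁`, the new Lévy measure off 0 is the law `μ_L` itself.
  have hmass : ∀ {γ b ν γ' b' ν'}, IsSubTriplet γ b ν 0 (Measure.dirac 1) γ' b' ν' →
      ∃ κ, IsConvPowers γ b ν κ ∧ ν' {1} = κ 1 {1} := by
    rintro γ b ν γ' b' ν' ⟨κ, hκ, -, -, -, -, hA⟩
    refine ⟨κ, hκ, ?_⟩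
    rw [hA {1} (measurableSet_singleton 1) (by simp), setLIntegral_dirac]
    simp
  have hD := hasTriplet_dirac 1
  -- The image `η` of `δ₁` has Lévy mass 1 at the point 1, so `η * η` has mass 2 there, more than
  -- any probability measure allows.
  obtain ⟨η, hη⟩ := exists_lambdaGraph hD.mem_ID hT
  refine ⟨μT, hT, fun hcl => ?_⟩
  have hmem := hcl η (mem_rangeT.2 ⟨_, hη⟩) η (mem_rangeT.2 ⟨_, hη⟩)
  obtain ⟨γ₁, b₁, ν₁, hs, ht⟩ := hη.exists_of hD hpair
  obtain ⟨κ, hκ, hκ1⟩ := hmass hs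
  have hκd : κ 1 = Measure.dirac 1 := by
    have := (hκ 1 zero_le_one).1
    refine Measure.ext_of_charFun (funext fun z => ?_)
    rw [(hκ 1 zero_le_one).2, hD.charFun_eq]
    simp
  obtain ⟨μL, hL⟩ := mem_rangeT.1 hmem
  obtain ⟨γ, b, ν, h1⟩ := exists_hasTriplet_of_mem_ID hL.1
  obtain ⟨γ₂, b₂, ν₂, hs₂, ht₂⟩ := hL.exists_of h1 hpair
  obtain ⟨κ', hκ', hκ1'⟩ := hmass hs₂
  obtain ⟨-, -, rfl⟩ := ht₂.unique (ht.conv ht)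
  have hP := (hκ' 1 zero_le_one).1
  have hle : κ' 1 {1} ≤ 1 := prob_le_one
  rw [← hκ1', Measure.add_apply, hκ1, hκd] at hle
  norm_num at hle

end LevySub

open LevySub in
theorem mainTheorem10 :
    -- `Λ` is single-valued
    (∀ μL μT μ₁ μ₂ : Measure ℝ, LambdaGraph μL μT μ₁ → LambdaGraph μL μT μ₂ → μ₁ = μ₂) ∧
    -- the domains
    (∀ μL ∈ ID, IDplus ⊆ domL μL ∧ (Nondegenerate μL → domL μL = IDplus)) ∧
    (∀ μT ∈ IDplus, domT μT = ID) ∧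
    -- the ranges are proper subsets of `ID(ℝ)`
    (∀ μL ∈ ID, rangeL μL ⊂ ID) ∧
    (∀ μT ∈ IDplus, Nondegenerate μT → rangeT μT ⊂ ID) ∧
    -- `Λ_{μ_L}` is a convolution homomorphism and its range is closed under convolution
    (∀ μL ∈ ID, ConvClosed (rangeL μL) ∧
      ∀ μ₁ ∈ domL μL, ∀ μ₂ ∈ domL μL,
        Measure.conv μ₁ μ₂ ∈ domL μL ∧
        Lambda μL (Measure.conv μ₁ μ₂) = Measure.conv (Lambda μL μ₁) (Lambda μL μ₂)) ∧
    -- the range of `Λ_{μ_T}` is in general not closed under convolution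
    (∃ μT ∈ IDplus, ¬ ConvClosed (rangeT μT)) := by
  refine ⟨fun _ _ _ _ => LambdaGraph.unique, fun μL hL => ⟨fun μT => exists_lambdaGraph hL,
    fun hn => ?_⟩, fun μT hT => ?_, fun μL => rangeL_ssubset, fun μT _ => rangeT_ssubset,
    fun μL _ => ⟨?_, ?_⟩, exists_rangeT_not_convClosed⟩
  · exact Set.Subset.antisymm (fun μT ⟨_, h⟩ => mem_IDplus_of_lambdaGraph hn h)
      fun μT => exists_lambdaGraph hL
  · exact Set.Subset.antisymm (fun μL ⟨_, h⟩ => h.1) fun μL hL => exists_lambdaGraph hL hT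
  · intro μ hμ η hη
    obtain ⟨μ₁, h₁⟩ := mem_rangeL.1 hμ
    obtain ⟨μ₂, h₂⟩ := mem_rangeL.1 hη
    exact mem_rangeL.2 ⟨_, h₁.conv h₂⟩
  · rintro μ₁ ⟨η₁, h₁⟩ μ₂ ⟨η₂, h₂⟩
    refine ⟨⟨_, h₁.conv h₂⟩, ?_⟩
    rw [(h₁.conv h₂).lambda_eq, h₁.lambda_eq, h₂.lambda_eq]
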